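/- Let $d,m\ge 0$ be integers, let $S_1,\dots,S_m\subset\mathbb R^d$ be (nonempty) affine subspaces of codimension at least $2$, and put $\mathcal Q=\mathbb R^d\setminus\bigcup_{\ell=1}^m S_\ell$. Let $j=(j^0,J):\mathbb R\times\mathcal Q\to\mathbb R\times\mathbb R^d$ be a current, i.e. a $C^1$ vector field such that $$\partial_t j^0+\sum_{i=1}^d\partial_{q_i}J_i=0,\qquad j^0(t,q)>0\ \text{ whenever } j(t,q)\neq 0,\qquad \int_{\mathcal Q}j^0(t,q)\,dq=1\ \text{ for all } t\in\mathbb R .$$ Suppose that there is a constant $c$ with $|J|\le c\,j^0$ on $\mathbb R\times\mathcal Q$, and that $J$ and the first-order partial derivatives of $j^0$ are bounded on every bounded subset of $\mathbb R\times\mathcal Q$. For $t\in\mathbb R$ let $\mu_t$ be the measure with density $j^0(t,\cdot)$ with respect to Lebesgue measure on $\mathcal Q$, regarded as a measure on $\mathbb R^d$. For $q\in\mathcal Q$ with $j(0,q)\ne0$ let $Q_q$ be the maximal solution of $$\frac{dQ}{dt}(t)=\frac{J(t,Q(t))}{j^0(t,Q(t))},\qquad Q(0)=q,$$ in $\{(t,x)\in\mathbb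 R\times\mathcal Q: j(t,x)\neq0\}$, defined on an open interval containing $0$. Let $\varphi_t(q)=Q_q(t)$ if $t$ belongs to this interval; otherwise, and also if $j(0,q)=0$ and $t\ne0$, let $\varphi_t(q)=\dagger$, an added cemetery point; and let $\varphi_0(q)=q$ for all $q$. Then for $\mu_0$-almost every $q\in\mathbb R^d$ the solution $Q_q$ exists for all times $t\in\mathbb R$, and the family $(\mu_t)_{t\in\mathbb R}$ is equivariant: $\mu_0\circ\varphi_t^{-1}=\mu_t$ for every $t\in\mathbb R$. -/

import Mathlib

open MeasureTheory Set

noncomputable section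

namespace CurrentFlow

/-- `d`-dimensional Euclidean space. -/
abbrev Space (d : ℕ) : Type := EuclideanSpace ℝ (Fin d)

/-- Space-time: points `(t, q)` with `t` the time and `q` the position. -/
abbrev SpaceTime (d : ℕ) : Type := ℝ × Space d

/-- `S` is a hyperplane of codimension at least `2`: a nonempty affine subspace of `ℝ^d`
of dimension at most `d - 2`. -/
def IsHyperplaneOfCodimGETwo {d : ℕ} (S : AffineSubspace ℝ (Space d)) : Prop :=
  (S : Set (Space d)).Nonempty ∧ Module.finrank ℝ S.direction + 2 ≤ d

/-- The configuration space `ℝ^d ∖ ⋃ₗ Sₗ`. -/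
def configSpace {d m : ℕ} (S : Fin m → AffineSubspace ℝ (Space d)) : Set (Space d) :=
  (⋃ l, (S l : Set (Space d)))ᶜ

/-- The part of space-time on which a current is defined, `ℝ × conf`. -/
def domain {d : ℕ} (conf : Set (Space d)) : Set (SpaceTime d) :=
  {p | p.2 ∈ conf}

/-- The space-time divergence `∂ₜ j⁰ + ∑ᵢ ∂_{qᵢ} Jᵢ` of the vector field `j = (j⁰, J)`. -/
def divergence {d : ℕ} (j : SpaceTime d → SpaceTime d) (p : SpaceTime d) : ℝ :=
  fderiv ℝ (fun x => (j x).1) p (1, 0) +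
    ∑ i : Fin d, fderiv ℝ (fun x => (j x).2 i) p (0, EuclideanSpace.single i 1)

/-- Current vector fields on `ℝ × conf`; the values of `j = (j⁰, J)` at points `(t, q)` with
`q ∉ conf` are irrelevant. -/
structure IsCurrent {d : ℕ} (conf : Set (Space d)) (j : SpaceTime d → SpaceTime d) : Prop where
  contDiffOn : ContDiffOn ℝ 1 j (domain conf)
  divergence_eq_zero : ∀ p ∈ domain conf, divergence j p = 0
  pos_of_ne_zero : ∀ p ∈ domain conf, j p ≠ 0 → 0 < (j p).1
  integral_eq_one : ∀ t : ℝ, ∫ q in conf, (j (t, q)).1 = 1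

/-- `Q` is, on the open interval `I ∋ 0`, a solution of `dQ/dt = J(t, Q) / j⁰(t, Q)` with
`Q(0) = q`. It stays in `conf` and off the nodes (the zeros of `j`), since the equation is defined
only there. -/
structure IsSolution {d : ℕ} (conf : Set (Space d)) (j : SpaceTime d → SpaceTime d)
    (q : Space d) (I : Set ℝ) (Q : ℝ → Space d) : Prop where
  isOpen : IsOpen I
  ordConnected : I.OrdConnected
  zero_mem : (0 : ℝ) ∈ I
  initial : Q 0 = q
  mem_conf : ∀ t ∈ I, Q t ∈ conf
  not_node : ∀ t ∈ I, j (t, Q t) ≠ 0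
  hasDerivAt : ∀ t ∈ I, HasDerivAt Q ((j (t, Q t)).1⁻¹ • (j (t, Q t)).2) t

/-- `Q` on `I` is the maximal solution starting in `q`: it extends every solution starting
in `q`. -/
def IsMaximalSolution {d : ℕ} (conf : Set (Space d)) (j : SpaceTime d → SpaceTime d)
    (q : Space d) (I : Set ℝ) (Q : ℝ → Space d) : Prop :=
  IsSolution conf j q I Q ∧
    ∀ (I' : Set ℝ) (Q' : ℝ → Space d), IsSolution conf j q I' Q' → I' ⊆ I ∧ EqOn Q' Q I'

open Classical in
/-- The flow map `φ_t`, with `none` as the cemetery configuration: `φ_t(q) = Q(t)` if `t` lies in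
the interval of existence of the maximal solution `Q` starting in `q`, and otherwise (in particular
if `(0, q)` is a node) the cemetery for `t ≠ 0` and `φ_0(q) = q`. Only the values at `q ∈ conf`
matter. -/
def flow {d : ℕ} (conf : Set (Space d)) (j : SpaceTime d → SpaceTime d) (t : ℝ) (q : Space d) :
    Option (Space d) :=
  if h : ∃ x : Space d, ∃ (I : Set ℝ) (Q : ℝ → Space d),
      IsMaximalSolution conf j q I Q ∧ t ∈ I ∧ x = Q t then
    some h.choose
  else if t = 0 then some q else none

/-- The measure `μ_t` with density `j⁰(t, ·)` with respect to Lebesgue measure on `conf`, as a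
measure on `ℝ^d` that gives no mass to the complement of `conf`. -/
def densityMeasure {d : ℕ} (conf : Set (Space d)) (j : SpaceTime d → SpaceTime d) (t : ℝ) :
    Measure (Space d) :=
  (volume.restrict conf).withDensity fun q => ENNReal.ofReal (j (t, q)).1

/-- The σ-algebra on `ℝ^d ∪ {cemetery}`: a set is measurable if its part in `ℝ^d` is Borel. -/
instance instMeasurableSpaceOptionSpace (d : ℕ) : MeasurableSpace (Option (Space d)) :=
  MeasurableSpace.map some inferInstance

/-- The distribution `ρ_t = μ_0 ∘ φ_t⁻¹` of `φ_t(q)` when `q` has distribution `μ_0`. -/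
def flowDistribution {d : ℕ} (conf : Set (Space d)) (j : SpaceTime d → SpaceTime d) (t : ℝ) :
    Measure (Option (Space d)) :=
  (densityMeasure conf j 0).map (flow conf j t)

/-- Equivariance of the family `μ_t` (on the time interval `ℝ`): for every `t` the map `φ_t` is
measurable up to `μ_0`-null sets and `ρ_t = μ_t`, where `μ_t` is regarded as a measure on
`ℝ^d ∪ {cemetery}` without mass at the cemetery. -/
def IsEquivariant {d : ℕ} (conf : Set (Space d)) (j : SpaceTime d → SpaceTime d) : Prop :=
  ∀ t : ℝ, AEMeasurable (flow conf j t) (densityMeasure conf j 0) ∧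
    flowDistribution conf j t = (densityMeasure conf j t).map some

/-- `f` is bounded on bounded subsets of `ℝ × conf`. -/
def BoundedOnBoundedSets {d : ℕ} {F : Type*} [SeminormedAddCommGroup F] (conf : Set (Space d))
    (f : SpaceTime d → F) : Prop :=
  ∀ B : Set (SpaceTime d), B ⊆ domain conf → Bornology.IsBounded B → ∃ C : ℝ, ∀ p ∈ B, ‖f p‖ ≤ C

end CurrentFlow

end

/-! Equivariance comes from Liouville's formula. Along a trajectory, the continuity equation and
Jacobi's formula make `j⁰(t, φ_t(q)) · det Dφ_t(q)` constant in time, hence equal to `j⁰(0, q)`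
(`exists_fderiv_flow`). Since `φ_t` is injective where trajectories survive, a change of variables
shows that the image of the surviving part of `μ_0` is at most `μ_t` (`lintegral_flow_le`). Both
`μ_0` and `μ_t` have mass 1, so if almost every trajectory survives until `t`, the inequality is an
equality (`equivariant_of_ae_survival`).

For survival, `|J| ≤ c j⁰` bounds the speed by `|c|`, so a trajectory ending at a finite time `b`
converges to some `x` with `(b, x)` outside the region (`exists_limit`): either `x` lies in some
`S_l` or `j(b, x) = 0`. In both cases a positive quantity, the squared distance to `S_l` or `j⁰`,
tends to 0 along the trajectory, so the integral of its logarithmic derivative diverges. The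
function `logRate` dominates all these logarithmic derivatives, and a finite integral of it excludes
an end (`not_exit`).

That integral is finite for almost every start because its `μ_0`-expectation is finite over starts
in a ball of radius `R` and times up to `T`. By Tonelli and `lintegral_flow_le` it is at most the
integral of `j⁰ · logRate` over `[0, T]` and the ball of radius `R + |c|T`. The weight `j⁰` cancels
the denominators `j⁰`, leaving bounded terms and multiples of `|J| / dist(·, S_l)`. The latter are
locally integrable because the codimension is at least 2 (`exists_rate_bound`). Negative times are
treated by reversing the current in time. -/

noncomputable section

namespace CurrentFlow

open Filter Topology Metric
open scoped NNReal ENNReal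

/-! ### Maximal solutions of locally Lipschitz differential equations. -/

section ODE

variable {E : Type*} [NormedAddCommGroup E] [NormedSpace ℝ E]

/-- A continuous time-dependent vector field on an open subset `G` of space-time that is locally
Lipschitz in the space variable. -/
structure IsLocLipField (G : Set (ℝ × E)) (V : ℝ × E → E) : Prop where
  isOpen : IsOpen G
  continuousOn : ContinuousOn V G
  lip : ∀ p ∈ G, ∃ U ∈ 𝓝 p, ∃ K : ℝ≥0, ∀ t : ℝ,
    LipschitzOnWith K (fun x => V (t, x)) {x | (t, x) ∈ U}

/-- `Q` solves `dQ/dt = V(t, Q)`, `Q(0) = q` in `G` on the open interval `I ∋ 0`. -/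
structure IsODESolution (G : Set (ℝ × E)) (V : ℝ × E → E) (q : E) (I : Set ℝ) (Q : ℝ → E) :
    Prop where
  isOpen : IsOpen I
  ordConnected : I.OrdConnected
  zero_mem : (0 : ℝ) ∈ I
  initial : Q 0 = q
  mem : ∀ t ∈ I, (t, Q t) ∈ G
  hasDerivAt : ∀ t ∈ I, HasDerivAt Q (V (t, Q t)) t

/-- The interval of existence of the maximal solution. -/
def maxDom (G : Set (ℝ × E)) (V : ℝ × E → E) (q : E) : Set ℝ :=
  {t | ∃ I Q, IsODESolution G V q I Q ∧ t ∈ I}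

open Classical in
/-- The maximal solution. -/
def maxSol (G : Set (ℝ × E)) (V : ℝ × E → E) (q : E) (t : ℝ) : E :=
  if h : ∃ Q I, IsODESolution G V q I Q ∧ t ∈ I then h.choose t else q

variable {G : Set (ℝ × E)} {V : ℝ × E → E} {q : E} {I : Set ℝ} {Q : ℝ → E}

theorem IsODESolution.continuousOn (h : IsODESolution G V q I Q) : ContinuousOn Q I :=
  fun t ht => (h.hasDerivAt t ht).continuousAt.continuousWithinAt

theorem IsODESolution.Icc_subset (h : IsODESolution G V q I Q) {T : ℝ} (hT : T ∈ I) :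
    Icc 0 T ⊆ I := h.ordConnected.out h.zero_mem hT

/-- Two integral curves that agree at one time agree on their common open interval. -/
theorem IsLocLipField.eqOn (hV : IsLocLipField G V) {f g : ℝ → E} {t₀ : ℝ}
    (hI : IsOpen I) (hI' : I.OrdConnected) (ht₀ : t₀ ∈ I)
    (hf : ∀ t ∈ I, (t, f t) ∈ G) (hf' : ∀ t ∈ I, HasDerivAt f (V (t, f t)) t)
    (hg' : ∀ t ∈ I, HasDerivAt g (V (t, g t)) t)
    (h0 : f t₀ = g t₀) : EqOn f g I := by
  have hfc : ContinuousOn f I := fun t ht => (hf' t ht).continuousAt.continuousWithinAt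
  have hgc : ContinuousOn g I := fun t ht => (hg' t ht).continuousAt.continuousWithinAt
  -- Agreement near a time, rather than at it, makes `u` open; local uniqueness and continuity make
  -- it relatively closed in the connected set `I`.
  set u : Set ℝ := {t | ∀ᶠ s in 𝓝 t, f s = g s} with hu
  have huo : IsOpen u := isOpen_setOfPred_eventually_nhds
  have key : ∀ t ∈ I, f t = g t → t ∈ u := by
    intro t ht hfg
    obtain ⟨U, hU, K, hK⟩ := hV.lip (t, f t) (hf t ht)
    have ev : ∀ k : ℝ → E, (∀ t ∈ I, HasDerivAt k (V (t, k t)) t) → k t = f t →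
        ∀ᶠ s in 𝓝 t, HasDerivAt k (V (s, k s)) s ∧ k s ∈ {x | (s, x) ∈ U} := by
      intro k hk hkf
      have hc : ContinuousAt (fun s => (s, k s)) t :=
        continuousAt_id.prodMk (hk t ht).continuousAt
      have : ∀ᶠ s in 𝓝 t, (s, k s) ∈ U := hc (by simpa [hkf] using hU)
      filter_upwards [this, hI.mem_nhds ht] with s hs hs'
      exact ⟨hk s hs', hs⟩
    exact ODE_solution_unique_of_eventually (v := fun t x => V (t, x))
      (s := fun s => {x | (s, x) ∈ U}) (Eventually.of_forall hK)
      (ev f hf' rfl) (ev g hg' hfg.symm) hfg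
  have hsub : I ⊆ u := by
    refine hI'.isPreconnected.subset_of_closure_inter_subset huo ⟨t₀, ht₀, key t₀ ht₀ h0⟩ ?_
    rintro t ⟨htc, ht⟩
    refine key t ht ?_
    have hfr : ∃ᶠ s in 𝓝 t, s ∈ u := mem_closure_iff_frequently.1 htc
    by_contra hne
    have : ∀ᶠ s in 𝓝 t, f s ≠ g s :=
      ((hf' t ht).continuousAt.prodMk (hg' t ht).continuousAt).eventually
        (isOpen_ne_fun continuous_fst continuous_snd |>.mem_nhds hne)
    obtain ⟨s, hs, hs'⟩ := (hfr.and_eventually this).exists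
    exact hs' hs.self_of_nhds
  exact fun t ht => (hsub ht).self_of_nhds

theorem IsLocLipField.solution_unique (hV : IsLocLipField G V) {I' : Set ℝ} {Q' : ℝ → E}
    (h : IsODESolution G V q I Q) (h' : IsODESolution G V q I' Q') : EqOn Q Q' (I ∩ I') :=
  hV.eqOn (h.isOpen.inter h'.isOpen) (h.ordConnected.inter h'.ordConnected)
    ⟨h.zero_mem, h'.zero_mem⟩ (fun t ht => h.mem t ht.1) (fun t ht => h.hasDerivAt t ht.1)
    (fun t ht => h'.hasDerivAt t ht.2) (h.initial.trans h'.initial.symm)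

theorem IsLocLipField.exists_local [CompleteSpace E] (hV : IsLocLipField G V) {t₀ : ℝ} {x₀ : E}
    (h : (t₀, x₀) ∈ G) : ∃ ε > 0, ∃ f : ℝ → E, f t₀ = x₀ ∧ ∀ t ∈ Ioo (t₀ - ε) (t₀ + ε),
      (t, f t) ∈ G ∧ HasDerivAt f (V (t, f t)) t := by
  obtain ⟨U, hU, K, hK⟩ := hV.lip _ h
  have hc : ContinuousAt V (t₀, x₀) := hV.continuousOn.continuousAt (hV.isOpen.mem_nhds h)
  have h1 : ∀ᶠ p in 𝓝 (t₀, x₀), p ∈ U ∧ p ∈ G ∧ ‖V p‖ < ‖V (t₀, x₀)‖ + 1 :=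
    (eventually_mem_set.2 hU).and ((eventually_mem_set.2 (hV.isOpen.mem_nhds h)).and
      (hc.norm.eventually (gt_mem_nhds (by simp))))
  obtain ⟨a, ha, hball⟩ := nhds_basis_closedBall.eventually_iff.1 h1
  set M : ℝ := ‖V (t₀, x₀)‖ + 1 with hM
  have hMpos : 0 < M := by positivity
  -- The bound `a` keeps times inside the ball; `a / M` keeps a curve of speed at most `M` within
  -- distance `a` of `x₀`.
  set δ : ℝ := min a (a / M) with hδ
  have hδpos : 0 < δ := lt_min ha (by positivity)
  have hmem : ∀ t ∈ Icc (t₀ - δ) (t₀ + δ), ∀ x ∈ closedBall x₀ a,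
      (t, x) ∈ closedBall (t₀, x₀) a := by
    intro t ht x hx
    rw [← closedBall_prod_same]
    refine ⟨?_, hx⟩
    rw [Real.closedBall_eq_Icc]
    have := min_le_left a (a / M)
    exact ⟨by linarith [ht.1], by linarith [ht.2]⟩
  have hPL : IsPicardLindelof (fun t x => V (t, x)) (tmin := t₀ - δ) (tmax := t₀ + δ)
      ⟨t₀, by linarith, by linarith⟩ x₀ ⟨a, ha.le⟩ 0 ⟨M, hMpos.le⟩ K := by
    refine ⟨fun t ht => (hK t).mono fun x hx => (hball (hmem t ht x hx)).1,
      fun x hx => ?_, fun t ht x hx => (hball (hmem t ht x hx)).2.2.le, ?_⟩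
    · exact hV.continuousOn.comp (by fun_prop) fun t ht => (hball (hmem t ht x hx)).2.1
    · have : M * δ ≤ a := by
        have := min_le_right a (a / M)
        calc M * δ ≤ M * (a / M) := by gcongr
          _ = a := by field_simp
      change M * max (t₀ + δ - t₀) (t₀ - (t₀ - δ)) ≤ a - 0
      simpa using this
  obtain ⟨f, hf0, hf⟩ := hPL.exists_eq_forall_mem_Icc_hasDerivWithinAt₀
  have hf0 : f t₀ = x₀ := hf0
  have hfd : ∀ t ∈ Ioo (t₀ - δ) (t₀ + δ), HasDerivAt f (V (t, f t)) t := fun t ht =>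
    (hf t (Ioo_subset_Icc_self ht)).hasDerivAt (Icc_mem_nhds ht.1 ht.2)
  have hcf : ContinuousAt (fun s => (s, f s)) t₀ :=
    continuousAt_id.prodMk (hfd t₀ ⟨by linarith, by linarith⟩).continuousAt
  have h2 : ∀ᶠ t in 𝓝 t₀, (t, f t) ∈ G :=
    hcf (by simpa [hf0] using hV.isOpen.mem_nhds h)
  obtain ⟨ε, hε, hεG⟩ := Metric.eventually_nhds_iff_ball.1 h2
  refine ⟨min ε δ, lt_min hε hδpos, f, hf0, fun t ht => ⟨hεG t ?_, hfd t ?_⟩⟩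
  · rw [Real.ball_eq_Ioo]
    have := min_le_left ε δ
    exact ⟨by linarith [ht.1], by linarith [ht.2]⟩
  · have := min_le_right ε δ
    exact ⟨by linarith [ht.1], by linarith [ht.2]⟩

theorem IsLocLipField.exists_solution [CompleteSpace E] (hV : IsLocLipField G V)
    (h : (0, q) ∈ G) : ∃ I Q, IsODESolution G V q I Q := by
  obtain ⟨ε, hε, f, hf0, hf⟩ := hV.exists_local h
  exact ⟨Ioo (0 - ε) (0 + ε), f, isOpen_Ioo, ordConnected_Ioo, by simp [hε], hf0,
    fun t ht => (hf t ht).1, fun t ht => (hf t ht).2⟩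

theorem IsLocLipField.maxSol_eqOn (hV : IsLocLipField G V) (h : IsODESolution G V q I Q) :
    EqOn Q (maxSol G V q) I := by
  intro t ht
  have hex : ∃ Q I, IsODESolution G V q I Q ∧ t ∈ I := ⟨Q, I, h, ht⟩
  rw [maxSol, dif_pos hex]
  obtain ⟨I', h', ht'⟩ := hex.choose_spec
  exact hV.solution_unique h h' ⟨ht, ht'⟩

theorem IsODESolution.subset_maxDom (h : IsODESolution G V q I Q) : I ⊆ maxDom G V q :=
  fun _ ht => ⟨I, Q, h, ht⟩

theorem IsLocLipField.isODESolution_maxSol [CompleteSpace E] (hV : IsLocLipField G V)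
    (h : (0, q) ∈ G) : IsODESolution G V q (maxDom G V q) (maxSol G V q) := by
  obtain ⟨I₀, Q₀, h₀⟩ := hV.exists_solution h
  have hnhds : ∀ {I Q t}, IsODESolution G V q I Q → t ∈ I → Q =ᶠ[𝓝 t] maxSol G V q :=
    fun hs ht => (hV.maxSol_eqOn hs).eventuallyEq_of_mem (hs.isOpen.mem_nhds ht)
  refine ⟨?_, ?_, h₀.subset_maxDom h₀.zero_mem, ?_, ?_, ?_⟩
  · rw [isOpen_iff_mem_nhds]
    rintro t ⟨I, Q, hs, ht⟩
    exact mem_of_superset (hs.isOpen.mem_nhds ht) hs.subset_maxDom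
  · have hpre : IsPreconnected (maxDom G V q) := by
      refine isPreconnected_of_forall 0 ?_
      rintro t ⟨I, Q, hs, ht⟩
      exact ⟨I, hs.subset_maxDom, hs.zero_mem, ht, hs.ordConnected.isPreconnected⟩
    exact hpre.ordConnected
  · rw [← hV.maxSol_eqOn h₀ h₀.zero_mem, h₀.initial]
  · rintro t ⟨I, Q, hs, ht⟩
    rw [← hV.maxSol_eqOn hs ht]
    exact hs.mem t ht
  · rintro t ⟨I, Q, hs, ht⟩
    rw [← hV.maxSol_eqOn hs ht]
    exact (hs.hasDerivAt t ht).congr_of_eventuallyEq (hnhds hs ht).symm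

/-- A maximal solution cannot converge to a point of `G` at a finite endpoint. -/
theorem IsLocLipField.notMem_of_tendsto [CompleteSpace E] (hV : IsLocLipField G V)
    (h : IsODESolution G V q I Q)
    {b : ℝ} (hb : 0 < b) (hbI : b ∉ I) (hsub : Ico 0 b ⊆ I)
    (hbm : b ∉ maxDom G V q) {x : E} (hx : Tendsto Q (𝓝[<] b) (𝓝 x)) : (b, x) ∉ G := by
  intro hG
  obtain ⟨ε, hε, f, hf0, hf⟩ := hV.exists_local hG
  have hlt : ∀ t ∈ I, t < b := by
    intro t ht
    by_contra hcon
    exact hbI (h.ordConnected.out h.zero_mem ht ⟨hb.le, not_lt.1 hcon⟩)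
  -- Glue a local solution through `(b, x)` to `Q`. At `b` the left derivative exists as the limit
  -- of the derivatives and matches the right one, so `R` would extend the maximal solution past
  -- `b`.
  set R : ℝ → E := fun t => if t < b then Q t else f t with hR
  have hR1 : ∀ t < b, R t = Q t := fun t ht => if_pos ht
  have hR2 : ∀ t, b ≤ t → R t = f t := fun t ht => if_neg (not_lt.2 ht)
  have hRQ : ∀ t < b, R =ᶠ[𝓝 t] Q := fun t ht => by
    filter_upwards [Iio_mem_nhds ht] with s hs using hR1 s hs
  have hRb : R b = x := (hR2 b le_rfl).trans hf0
  have hdl : ∀ t ∈ I, HasDerivAt R (V (t, R t)) t := fun t ht => by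
    rw [hR1 t (hlt t ht)]
    exact (h.hasDerivAt t ht).congr_of_eventuallyEq (hRQ t (hlt t ht))
  have hRx : Tendsto R (𝓝[<] b) (𝓝 x) :=
    hx.congr' (by filter_upwards [self_mem_nhdsWithin] with s hs using (hR1 s hs).symm)
  have hIoo : Ioo 0 b ∈ 𝓝[<] b := Ioo_mem_nhdsLT hb
  have hleft : HasDerivWithinAt R (V (b, x)) (Iic b) b := by
    refine hasDerivWithinAt_Iic_of_tendsto_deriv (s := Ioo 0 b) ?_ ?_ hIoo ?_
    · exact fun t ht => (hdl t (hsub (Ioo_subset_Ico_self ht))).differentiableAt.differentiableWithinAt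
    · rw [ContinuousWithinAt, hRb]
      exact hRx.mono_left (nhdsWithin_mono _ fun t ht => ht.2)
    · have h1 : Tendsto (fun t => V (t, R t)) (𝓝[<] b) (𝓝 (V (b, x))) := by
        have hc : ContinuousAt V (b, x) := hV.continuousOn.continuousAt (hV.isOpen.mem_nhds hG)
        exact hc.tendsto.comp ((tendsto_id.mono_left nhdsWithin_le_nhds).prodMk_nhds hRx)
      refine h1.congr' ?_
      filter_upwards [hIoo] with t ht
      exact (hdl t (hsub (Ioo_subset_Ico_self ht))).deriv.symm
  have hright : HasDerivWithinAt R (V (b, x)) (Ici b) b := by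
    have := (hf b ⟨by linarith, by linarith⟩).2.hasDerivWithinAt (s := Ici b)
    rw [hf0] at this
    exact this.congr (fun t ht => hR2 t ht) (hR2 b le_rfl)
  have hderb : HasDerivAt R (V (b, R b)) b := by
    rw [hRb]
    have := hleft.union hright
    rwa [Iic_union_Ici, hasDerivWithinAt_univ] at this
  have hmemJ : ∀ t ∈ I ∪ Ioo 0 (b + ε), t ∈ I ∨ t = b ∨ (b < t ∧ t ∈ Ioo (b - ε) (b + ε)) := by
    rintro t (ht | ht)
    · exact Or.inl ht
    · rcases lt_trichotomy t b with h1 | h1 | h1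
      · exact Or.inl (hsub ⟨ht.1.le, h1⟩)
      · exact Or.inr (Or.inl h1)
      · exact Or.inr (Or.inr ⟨h1, by linarith, ht.2⟩)
  have hsol : IsODESolution G V q (I ∪ Ioo 0 (b + ε)) R := by
    refine ⟨h.isOpen.union isOpen_Ioo, ?_, Or.inl h.zero_mem, ?_, ?_, ?_⟩
    · have hne : (I ∩ Ioo 0 (b + ε)).Nonempty :=
        ⟨b / 2, hsub ⟨by linarith, by linarith⟩, by linarith, by linarith⟩
      exact (h.ordConnected.isPreconnected.union' hne isPreconnected_Ioo).ordConnected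
    · rw [hR1 0 hb, h.initial]
    · intro t ht
      rcases hmemJ t ht with h1 | h1 | ⟨h1, h2⟩
      · rw [hR1 t (hlt t h1)]; exact h.mem t h1
      · rw [h1, hRb]; exact hG
      · rw [hR2 t h1.le]; exact (hf t h2).1
    · intro t ht
      rcases hmemJ t ht with h1 | h1 | ⟨h1, h2⟩
      · exact hdl t h1
      · rw [h1]; exact hderb
      · rw [hR2 t h1.le]
        refine (hf t h2).2.congr_of_eventuallyEq ?_
        filter_upwards [Ioi_mem_nhds h1] with s hs using hR2 s (le_of_lt hs)
  exact hbm (hsol.subset_maxDom (Or.inr ⟨hb, by linarith⟩))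

/-- A bounded derivative makes `f` Lipschitz, so its values are Cauchy as `t` increases to `b`. -/
theorem exists_tendsto_of_bounded_deriv [CompleteSpace E] {f f' : ℝ → E} {a b M : ℝ} (hab : a < b)
    (hf : ∀ t ∈ Ico a b, HasDerivAt f (f' t) t) (hM : ∀ t ∈ Ico a b, ‖f' t‖ ≤ M) :
    ∃ x, Tendsto f (𝓝[<] b) (𝓝 x) := by
  have hM0 : 0 ≤ M := (norm_nonneg _).trans (hM a ⟨le_rfl, hab⟩)
  have hlip : ∀ s ∈ Ico a b, ∀ t ∈ Ico a b, dist (f t) (f s) ≤ M * dist t s := by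
    intro s hs t ht
    rw [dist_eq_norm, dist_eq_norm]
    exact (convex_Ico a b).norm_image_sub_le_of_norm_hasDerivWithin_le
      (fun t ht => (hf t ht).hasDerivWithinAt) hM hs ht
  refine CompleteSpace.complete (f := map f (𝓝[<] b)) ?_
  rw [Metric.cauchy_iff]
  refine ⟨inferInstance, fun ε hε => ?_⟩
  -- The `+ 1` allows `M = 0` and makes the final estimate strict.
  set δ := ε / (M + 1) with hδ
  have hδ0 : 0 < δ := by positivity
  refine ⟨f '' Ioo (max a (b - δ)) b, image_mem_map (Ioo_mem_nhdsLT (by simp [hab, hδ0])), ?_⟩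
  rintro _ ⟨t, ht, rfl⟩ _ ⟨s, hs, rfl⟩
  have h1 := le_max_left a (b - δ)
  have h2 := le_max_right a (b - δ)
  have h3 : dist t s ≤ δ := by
    rw [Real.dist_eq, abs_le]
    constructor <;> linarith [ht.1, ht.2, hs.1, hs.2]
  calc dist (f t) (f s) ≤ M * dist t s :=
        hlip s ⟨by linarith [hs.1], hs.2⟩ t ⟨by linarith [ht.1], ht.2⟩
    _ ≤ M * δ := by gcongr
    _ < (M + 1) * δ := by nlinarith
    _ = ε := by rw [hδ]; field_simp

theorem exists_first_exit {I : Set ℝ} (hI : IsOpen I) (h0 : (0 : ℝ) ∈ I) {T : ℝ}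
    (h : ¬ Icc 0 T ⊆ I) : ∃ b, 0 < b ∧ b ≤ T ∧ b ∉ I ∧ Ico 0 b ⊆ I := by
  obtain ⟨t, ht, htI⟩ := not_subset.1 h
  have hcl : IsClosed (Icc 0 T \ I) := isClosed_Icc.sdiff hI
  obtain ⟨b, hb, hmin⟩ := (isCompact_Icc.of_isClosed_subset hcl sdiff_subset).exists_isLeast
    ⟨t, ht, htI⟩
  have hb0 : b ≠ 0 := fun hb0 => hb.2 (hb0 ▸ h0)
  refine ⟨b, lt_of_le_of_ne hb.1.1 hb0.symm, hb.1.2, hb.2, fun s hs => ?_⟩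
  by_contra hsI
  exact absurd (hmin ⟨⟨hs.1, hs.2.le.trans hb.1.2⟩, hsI⟩) (not_le.2 hs.2)

/-- If a maximal solution with bounded speed does not exist on all of `[0, T]`, then it converges
to a point outside `G`. -/
theorem IsLocLipField.exists_limit [CompleteSpace E] (hV : IsLocLipField G V) (h0 : (0, q) ∈ G)
    {b M : ℝ} (hb : 0 < b) (hbI : b ∉ maxDom G V q)
    (hsub : Ico 0 b ⊆ maxDom G V q)
    (hM : ∀ t ∈ Ico 0 b, ‖V (t, maxSol G V q t)‖ ≤ M) :
    ∃ x, Tendsto (maxSol G V q) (𝓝[<] b) (𝓝 x) ∧ (b, x) ∉ G := by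
  have h := hV.isODESolution_maxSol h0
  obtain ⟨x, hx⟩ := exists_tendsto_of_bounded_deriv hb (fun t ht => h.hasDerivAt t (hsub ht)) hM
  exact ⟨x, hx, hV.notMem_of_tendsto h hb hbI hsub hbI hx⟩

/-- Linear differential equations have solutions on the whole interval. -/
theorem exists_linear_solution [CompleteSpace E] {A : ℝ → E →L[ℝ] E} {I : Set ℝ} (hI : IsOpen I)
    (hA : ContinuousOn A I) {T : ℝ} (hT : Icc 0 T ⊆ I) (h0I : (0 : ℝ) ∈ I) (y₀ : E) :
    ∃ Y : ℝ → E, Y 0 = y₀ ∧ ∀ s ∈ Icc 0 T, HasDerivAt Y (A s (Y s)) s := by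
  set W : ℝ × E → E := fun p => A p.1 p.2 with hW
  have hfield : IsLocLipField (I ×ˢ (univ : Set E)) W := by
    refine ⟨hI.prod isOpen_univ, ?_, ?_⟩
    · exact (hA.comp continuousOn_fst fun p hp => hp.1).clm_apply continuousOn_snd
    · rintro ⟨t, x⟩ ⟨ht, -⟩
      have hc : ContinuousAt A t := hA.continuousAt (hI.mem_nhds ht)
      have h1 : ∀ᶠ s in 𝓝 t, ‖A s‖ < ‖A t‖ + 1 :=
        hc.norm.eventually (gt_mem_nhds (by simp))
      refine ⟨{p | ‖A p.1‖ < ‖A t‖ + 1}, (continuousAt_fst (p := (t, x))).eventually h1,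
        (‖A t‖ + 1).toNNReal, fun s => ?_⟩
      refine LipschitzOnWith.of_dist_le_mul fun y hy z hz => ?_
      rw [Real.coe_toNNReal _ (by positivity), dist_eq_norm, dist_eq_norm, hW]
      simp only [← map_sub]
      exact ((A s).le_opNorm _).trans (by gcongr; exact le_of_lt hy)
  have h0 : ((0 : ℝ), y₀) ∈ I ×ˢ (univ : Set E) := ⟨h0I, mem_univ _⟩
  have hsol := hfield.isODESolution_maxSol h0
  suffices hs : Icc 0 T ⊆ maxDom (I ×ˢ univ) W y₀ from
    ⟨_, hsol.initial, fun s hs' => hsol.hasDerivAt s (hs hs')⟩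
  -- If the solution ended at `b ≤ T`, Gronwall would bound it and hence its speed; its limit would
  -- then lie in `I × E`, contrary to `exists_limit`.
  by_contra hcon
  obtain ⟨b, hb, hbT, hbI, hsub⟩ := exists_first_exit hsol.isOpen hsol.zero_mem hcon
  obtain ⟨M, hM⟩ : ∃ M, ∀ s ∈ Icc 0 T, ‖A s‖ ≤ M :=
    isCompact_Icc.exists_bound_of_continuousOn (hA.mono hT)
  have hM0 : 0 ≤ M := (norm_nonneg _).trans (hM 0 ⟨le_rfl, hb.le.trans hbT⟩)
  set Y := maxSol (I ×ˢ univ) W y₀ with hY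
  have hbound : ∀ t ∈ Ico 0 b, ‖Y t‖ ≤ ‖y₀‖ * Real.exp (M * b) := by
    intro t ht
    have hsub' : Icc 0 t ⊆ maxDom (I ×ˢ univ) W y₀ := fun s hs => hsub ⟨hs.1, hs.2.trans_lt ht.2⟩
    have := norm_le_gronwallBound_of_norm_deriv_right_le (f := Y) (f' := fun s => A s (Y s))
      (δ := ‖y₀‖) (K := M) (ε := 0) (hsol.continuousOn.mono hsub')
      (fun s hs => (hsol.hasDerivAt s (hsub' (Ico_subset_Icc_self hs))).hasDerivWithinAt)
      (congrArg norm hsol.initial).le (fun s hs => by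
        rw [add_zero]
        refine ((A s).le_opNorm _).trans ?_
        gcongr
        exact hM s ⟨hs.1, by linarith [hs.2, ht.2]⟩) t ⟨ht.1, le_rfl⟩
    rw [gronwallBound_ε0] at this
    refine this.trans ?_
    have : M * (t - 0) ≤ M * b := by gcongr; linarith [ht.2]
    gcongr
  obtain ⟨x, -, hx⟩ := hfield.exists_limit h0 hb hbI hsub (M := M * (‖y₀‖ * Real.exp (M * b)))
    (fun t ht => ((A t).le_opNorm _).trans (by
      have := hM t ⟨ht.1, ht.2.le.trans hbT⟩
      have := hbound t ht
      gcongr))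
  exact hx ⟨hT ⟨hb.le, hbT⟩, mem_univ _⟩

/-! ### Dependence on the initial value. -/

theorem isCompact_graph {X : Type*} [TopologicalSpace X] {f : ℝ → X} {T : ℝ} (hf : ContinuousOn f (Icc 0 T)) :
    IsCompact ((fun s => (s, f s)) '' Icc 0 T) :=
  isCompact_Icc.image_of_continuousOn (continuousOn_id.prodMk hf)

/-- A uniform neighbourhood of a compact integral curve in which the field is Lipschitz. -/
theorem IsLocLipField.exists_tube (hV : IsLocLipField G V) {f : ℝ → E} {T : ℝ}
    (hf : ContinuousOn f (Icc 0 T)) (hG : ∀ s ∈ Icc 0 T, (s, f s) ∈ G) :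
    ∃ ε > 0, ∃ K : ℝ≥0, ∀ s ∈ Icc 0 T, (∀ x ∈ ball (f s) ε, (s, x) ∈ G) ∧
      LipschitzOnWith K (fun x => V (s, x)) (ball (f s) ε) := by
  have hcov : ∀ p ∈ (fun s => (s, f s)) '' Icc 0 T, ∃ U : Set (ℝ × E), IsOpen U ∧ p ∈ U ∧ U ⊆ G ∧
      ∃ K : ℝ≥0, ∀ t, LipschitzOnWith K (fun x => V (t, x)) {x | (t, x) ∈ U} := by
    rintro _ ⟨s, hs, rfl⟩
    obtain ⟨U, hU, K, hK⟩ := hV.lip _ (hG s hs)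
    refine ⟨interior U ∩ G, isOpen_interior.inter hV.isOpen,
      ⟨mem_interior_iff_mem_nhds.2 hU, hG s hs⟩, inter_subset_right, K, fun t => ?_⟩
    exact (hK t).mono fun x hx => (interior_subset hx.1 : (t, x) ∈ U)
  choose! U hUo hUm hUG K hK using hcov
  obtain ⟨F, hF, hFc⟩ := (isCompact_graph hf).elim_nhds_subcover U
    fun p hp => (hUo p hp).mem_nhds (hUm p hp)
  obtain ⟨ε, hε, hball⟩ := lebesgue_number_lemma_of_metric (ι := F) (c := fun i => U i)
    (isCompact_graph hf) (fun i => hUo i (hF i i.2)) (by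
      intro p hp
      obtain ⟨i, hi, hpi⟩ := mem_iUnion₂.1 (hFc hp)
      exact mem_iUnion.2 ⟨⟨i, hi⟩, hpi⟩)
  refine ⟨ε, hε, F.sup K, fun s hs => ?_⟩
  obtain ⟨⟨i, hi⟩, hsub⟩ := hball _ (mem_image_of_mem _ hs)
  have hmem : ∀ x ∈ ball (f s) ε, (s, x) ∈ U i := fun x hx => hsub (by
    rw [← ball_prod_same]
    exact ⟨mem_ball_self hε, hx⟩)
  refine ⟨fun x hx => hUG i (hF i hi) (hmem x hx), ?_⟩
  exact ((hK i (hF i hi) s).mono hmem).weaken (Finset.le_sup hi)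

/-- Lipschitz dependence on the initial value. -/
theorem IsLocLipField.exists_lipschitz_dependence [CompleteSpace E] (hV : IsLocLipField G V)
    (h0 : (0, q) ∈ G) {T : ℝ} (hT : 0 ≤ T) (hsub : Icc 0 T ⊆ maxDom G V q) :
    ∃ δ > 0, ∃ L : ℝ, 0 ≤ L ∧ ∀ q' ∈ ball q δ, (0, q') ∈ G ∧ Icc 0 T ⊆ maxDom G V q' ∧
      ∀ s ∈ Icc 0 T, ‖maxSol G V q' s - maxSol G V q s‖ ≤ L * ‖q' - q‖ := by
  have hq := hV.isODESolution_maxSol h0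
  set Q := maxSol G V q with hQ
  have hQc : ContinuousOn Q (Icc 0 T) := hq.continuousOn.mono hsub
  obtain ⟨ε, hε, K, htube⟩ := hV.exists_tube hQc fun s hs => hq.mem s (hsub hs)
  set L : ℝ := Real.exp (K * T) with hL
  have hL1 : 1 ≤ L := Real.one_le_exp (by positivity)
  -- With this choice the Gronwall bound `L * dist q' q` stays strictly below the tube radius `ε`.
  set δ : ℝ := ε / (2 * L) with hδ
  have hδ0 : 0 < δ := by positivity
  have hδε : δ ≤ ε / 2 := by
    rw [hδ, div_le_div_iff₀ (by positivity) (by positivity)]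
    nlinarith
  refine ⟨δ, hδ0, L, by positivity, fun q' hq' => ?_⟩
  have h0T : (0 : ℝ) ∈ Icc 0 T := ⟨le_rfl, hT⟩
  have hQ0 : Q 0 = q := hq.initial
  have hq'G : (0, q') ∈ G := (htube 0 h0T).1 q' (by
    rw [hQ0]; exact ball_subset_ball (by linarith) hq')
  have hs' := hV.isODESolution_maxSol hq'G
  set Q' := maxSol G V q' with hQ'
  have hQ'0 : Q' 0 = q' := hs'.initial
  have hq'd : L * dist q' q < ε := by
    have h1 : dist q' q < δ := hq'
    calc L * dist q' q < L * δ := by gcongr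
      _ = ε / 2 := by rw [hδ]; field_simp
      _ < ε := by linarith
  -- Gronwall's inequality as long as the solution stays in the tube
  have hgron : ∀ t ∈ Icc 0 T, Icc 0 t ⊆ maxDom G V q' → (∀ s ∈ Ico 0 t, dist (Q' s) (Q s) < ε) →
      ∀ s ∈ Icc 0 t, dist (Q' s) (Q s) ≤ L * dist q' q := by
    intro t ht hsub' hclose s hs
    have hss : Icc 0 t ⊆ Icc 0 T := Icc_subset_Icc_right ht.2
    have := dist_le_of_trajectories_ODE_of_mem (v := fun t x => V (t, x))
      (s := fun s => ball (Q s) ε) (K := K) (f := Q') (g := Q) (a := 0) (b := t)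
      (δ := dist q' q) (fun r hr => (htube r (hss (Ico_subset_Icc_self hr))).2)
      (hs'.continuousOn.mono hsub')
      (fun r hr => (hs'.hasDerivAt r (hsub' (Ico_subset_Icc_self hr))).hasDerivWithinAt)
      hclose (hQc.mono hss)
      (fun r hr => (hq.hasDerivAt r (hsub (hss (Ico_subset_Icc_self hr)))).hasDerivWithinAt)
      (fun r _ => mem_ball_self hε) (by rw [hQ0, hQ'0]) s hs
    refine this.trans ?_
    rw [mul_comm]
    have h2 : (K : ℝ) * (s - 0) ≤ K * T := by gcongr; linarith [hs.2, ht.2]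
    rw [hL]
    gcongr
  -- At the first time the distance reaches `ε`, Gronwall still applies and gives a distance less
  -- than `ε`.
  have hstay : ∀ t ∈ Icc 0 T, Icc 0 t ⊆ maxDom G V q' → dist (Q' t) (Q t) < ε := by
    intro t ht hsub'
    by_contra hcon
    have hcl : IsClosed (Icc 0 t ∩ (fun s => dist (Q' s) (Q s)) ⁻¹' Ici ε) :=
      ContinuousOn.preimage_isClosed_of_isClosed
        (continuous_dist.comp_continuousOn
          ((hs'.continuousOn.mono hsub').prodMk (hQc.mono (Icc_subset_Icc_right ht.2))))
        isClosed_Icc isClosed_Ici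
    obtain ⟨b, hb, hmin⟩ := (isCompact_Icc.of_isClosed_subset hcl inter_subset_left).exists_isLeast
      ⟨t, ⟨ht.1, le_rfl⟩, not_lt.1 hcon⟩
    have hb1 : b ∈ Icc 0 T := ⟨hb.1.1, hb.1.2.trans ht.2⟩
    have hlt : ∀ s ∈ Ico 0 b, dist (Q' s) (Q s) < ε := by
      intro s hs
      by_contra hcon
      exact absurd (hmin ⟨⟨hs.1, hs.2.le.trans hb.1.2⟩, not_lt.1 hcon⟩) (not_le.2 hs.2)
    have h3 := hgron b hb1 ((Icc_subset_Icc_right hb.1.2).trans hsub') hlt b ⟨hb.1.1, le_rfl⟩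
    have h4 : ε ≤ dist (Q' b) (Q b) := hb.2
    linarith
  -- In the tube the speed is bounded, so a premature end would have a limit; that limit is still in
  -- the tube, hence in `G`.
  have hdom : Icc 0 T ⊆ maxDom G V q' := by
    by_contra hcon
    obtain ⟨b, hb, hbT, hbI, hsub'⟩ := exists_first_exit hs'.isOpen hs'.zero_mem hcon
    have hin : ∀ t ∈ Ico 0 b, t ∈ Icc 0 T ∧ dist (Q' t) (Q t) ≤ L * dist q' q := by
      intro t ht
      have ht' : t ∈ Icc 0 T := ⟨ht.1, ht.2.le.trans hbT⟩
      have hst : ∀ s ≤ t, Icc 0 s ⊆ maxDom G V q' :=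
        fun s hs => fun r hr => hsub' ⟨hr.1, (hr.2.trans hs).trans_lt ht.2⟩
      refine ⟨ht', hgron t ht' (hst t le_rfl) (fun s hs => ?_) t ⟨ht.1, le_rfl⟩⟩
      exact hstay s ⟨hs.1, hs.2.le.trans ht'.2⟩ (hst s hs.2.le)
    obtain ⟨M, hM⟩ : ∃ M, ∀ s ∈ Icc 0 T, ‖V (s, Q s)‖ ≤ M :=
      isCompact_Icc.exists_bound_of_continuousOn
        (hV.continuousOn.comp (continuousOn_id.prodMk hQc) fun s hs => hq.mem s (hsub hs))
    have hbound : ∀ t ∈ Ico 0 b, ‖V (t, Q' t)‖ ≤ M + K * ε := by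
      intro t ht
      obtain ⟨ht', htd⟩ := hin t ht
      have h5 : dist (V (t, Q' t)) (V (t, Q t)) ≤ K * dist (Q' t) (Q t) :=
        (htube t ht').2.dist_le_mul _ (htd.trans_lt hq'd) _ (mem_ball_self hε)
      have h6 : (K : ℝ) * dist (Q' t) (Q t) ≤ K * ε := by gcongr; linarith
      rw [dist_eq_norm] at h5
      linarith [norm_le_norm_sub_add (V (t, Q' t)) (V (t, Q t)), hM t ht']
    obtain ⟨x, hx, hxG⟩ := hV.exists_limit hq'G hb hbI hsub' hbound
    have hbT' : b ∈ Icc 0 T := ⟨hb.le, hbT⟩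
    have hQb : Tendsto Q (𝓝[<] b) (𝓝 (Q b)) :=
      (hq.hasDerivAt b (hsub hbT')).continuousAt.tendsto.mono_left nhdsWithin_le_nhds
    have hle : dist x (Q b) ≤ L * dist q' q :=
      le_of_tendsto (hx.dist hQb) (by
        filter_upwards [Ioo_mem_nhdsLT hb] with t ht using (hin t (Ioo_subset_Ico_self ht)).2)
    exact hxG ((htube b hbT').1 x (hle.trans_lt hq'd))
  refine ⟨hq'G, hdom, fun s hs => ?_⟩
  rw [← dist_eq_norm, ← dist_eq_norm]
  exact hgron T ⟨hT, le_rfl⟩ hdom (fun r hr => hstay r (Ico_subset_Icc_self hr)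
    ((Icc_subset_Icc_right hr.2.le).trans hdom)) s hs

/-- The initial values whose maximal solution exists at time `t`. -/
def survivalSet (G : Set (ℝ × E)) (V : ℝ × E → E) (t : ℝ) : Set E :=
  {q | (0, q) ∈ G ∧ t ∈ maxDom G V q}

theorem IsLocLipField.Icc_subset_maxDom [CompleteSpace E] (hV : IsLocLipField G V) {t : ℝ}
    (h : q ∈ survivalSet G V t) : Icc 0 t ⊆ maxDom G V q :=
  (hV.isODESolution_maxSol h.1).Icc_subset h.2

theorem IsLocLipField.isOpen_survivalSet [CompleteSpace E] (hV : IsLocLipField G V) {t : ℝ}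
    (ht : 0 ≤ t) : IsOpen (survivalSet G V t) := by
  rw [Metric.isOpen_iff]
  intro q hq
  obtain ⟨δ, hδ, L, -, h⟩ := hV.exists_lipschitz_dependence hq.1 ht (hV.Icc_subset_maxDom hq)
  exact ⟨δ, hδ, fun q' hq' => ⟨(h q' hq').1, (h q' hq').2.1 ⟨ht, le_rfl⟩⟩⟩

/-- The pairs `(q, t)`, `t > 0`, for which the maximal solution from `q` exists at time `t`. -/
def forwardDomain (G : Set (ℝ × E)) (V : ℝ × E → E) : Set (E × ℝ) :=
  {z | 0 < z.2 ∧ z.1 ∈ survivalSet G V z.2}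

/-- Existence persists to some `T > t`. Lipschitz dependence on `[0, T]`, combined with continuity
of the single trajectory from `q`, gives both joint openness and joint continuity, which later
provide the measurability for Tonelli. -/
theorem IsLocLipField.forwardDomain_nhds [CompleteSpace E] (hV : IsLocLipField G V) {z : E × ℝ}
    (hz : z ∈ forwardDomain G V) : ∀ᶠ y in 𝓝 z, y ∈ forwardDomain G V ∧
      ContinuousAt (fun y : E × ℝ => maxSol G V y.1 y.2) z := by
  obtain ⟨q, t⟩ := z
  obtain ⟨ht, hq⟩ := hz
  have hs := hV.isODESolution_maxSol hq.1
  obtain ⟨T, hT, hTsub⟩ : ∃ T, t < T ∧ Icc 0 T ⊆ maxDom G V q := by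
    obtain ⟨T, hT, hTt⟩ := ((hs.isOpen.mem_nhds hq.2 : _ ∈ 𝓝 t) |> fun h =>
      (mem_nhdsGT_iff_exists_Ioc_subset (a := t)).1 (nhdsWithin_le_nhds h))
    exact ⟨T, hT, hs.Icc_subset (hTt ⟨hT, le_rfl⟩)⟩
  obtain ⟨δ, hδ, L, hL, h⟩ := hV.exists_lipschitz_dependence hq.1 (ht.trans hT).le hTsub
  have hnear : ∀ᶠ y : E × ℝ in 𝓝 (q, t), y.1 ∈ ball q δ ∧ y.2 ∈ Ioo 0 T :=
    ((continuousAt_fst (p := (q, t))).eventually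
      (eventually_mem_set.2 (ball_mem_nhds q hδ))).and
      ((continuousAt_snd (p := (q, t))).eventually (eventually_mem_set.2 (Ioo_mem_nhds ht hT)))
  have hcont : ContinuousAt (fun y : E × ℝ => maxSol G V y.1 y.2) (q, t) := by
    have h1 : Tendsto (fun y : E × ℝ => maxSol G V q y.2) (𝓝 (q, t)) (𝓝 (maxSol G V q t)) :=
      (hs.hasDerivAt t hq.2).continuousAt.tendsto.comp continuousAt_snd
    have h2 : Tendsto (fun y : E × ℝ => maxSol G V y.1 y.2 - maxSol G V q y.2) (𝓝 (q, t))
        (𝓝 0) := by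
      have h3 : Tendsto (fun y : E × ℝ => L * ‖y.1 - q‖) (𝓝 (q, t)) (𝓝 0) := by
        have : ContinuousAt (fun y : E × ℝ => L * ‖y.1 - q‖) (q, t) := by fun_prop
        simpa [ContinuousAt] using this
      refine squeeze_zero_norm' ?_ h3
      filter_upwards [hnear] with y hy
      exact (h y.1 hy.1).2.2 y.2 (Ioo_subset_Icc_self hy.2)
    simpa [ContinuousAt] using h2.add h1
  filter_upwards [hnear] with y hy
  exact ⟨⟨hy.2.1, (h y.1 hy.1).1, (h y.1 hy.1).2.1 (Ioo_subset_Icc_self hy.2)⟩, hcont⟩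

theorem IsLocLipField.isOpen_forwardDomain [CompleteSpace E] (hV : IsLocLipField G V) :
    IsOpen (forwardDomain G V) :=
  isOpen_iff_mem_nhds.2 fun _ hz => (hV.forwardDomain_nhds hz).mono fun _ h => h.1

theorem IsLocLipField.continuousOn_forwardDomain [CompleteSpace E] (hV : IsLocLipField G V) :
    ContinuousOn (fun y : E × ℝ => maxSol G V y.1 y.2) (forwardDomain G V) :=
  fun _ hz => (hV.forwardDomain_nhds hz).self_of_nhds.2.continuousWithinAt

/-- Two trajectories that meet at time `t` coincide back to time 0. -/
theorem IsLocLipField.injOn_maxSol [CompleteSpace E] (hV : IsLocLipField G V) (t : ℝ) :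
    InjOn (fun q => maxSol G V q t) (survivalSet G V t) := by
  intro q hq q' hq' heq
  have h := hV.isODESolution_maxSol hq.1
  have h' := hV.isODESolution_maxSol hq'.1
  have := hV.eqOn (f := maxSol G V q) (g := maxSol G V q') (h.isOpen.inter h'.isOpen)
    (h.ordConnected.inter h'.ordConnected) ⟨hq.2, hq'.2⟩ (fun t ht => h.mem t ht.1)
    (fun t ht => h.hasDerivAt t ht.1) (fun t ht => h'.hasDerivAt t ht.2) heq
    ⟨h.zero_mem, h'.zero_mem⟩
  rwa [h.initial, h'.initial] at this

/-! ### Differentiability of the flow of a continuously differentiable field. -/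

theorem isLocLipField_of_contDiffOn (hG : IsOpen G) (hV : ContDiffOn ℝ 1 V G) :
    IsLocLipField G V := by
  refine ⟨hG, hV.continuousOn, fun p hp => ?_⟩
  obtain ⟨K, U, hU, hK⟩ := (hV.contDiffAt (hG.mem_nhds hp)).exists_lipschitzOnWith
  refine ⟨U, hU, K, fun t => LipschitzOnWith.of_dist_le_mul fun x hx y hy => ?_⟩
  have := hK.dist_le_mul (t, x) hx (t, y) hy
  rwa [Prod.dist_eq, dist_self, max_eq_right dist_nonneg] at this

/-- The spatial derivative of `V`. -/
def spaceDeriv (V : ℝ × E → E) (p : ℝ × E) : E →L[ℝ] E :=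
  (fderiv ℝ V p).comp (ContinuousLinearMap.inr ℝ ℝ E)

theorem continuousOn_spaceDeriv (hG : IsOpen G) (hV : ContDiffOn ℝ 1 V G) :
    ContinuousOn (spaceDeriv V) G :=
  (hV.continuousOn_fderiv_of_isOpen hG le_rfl).clm_comp continuousOn_const

/-- Strict differentiability together with continuity of the derivative gives the estimate near each
point of the graph with a varying base point; a Lebesgue number of the compact graph makes the
radius uniform. -/
theorem exists_uniform_linearization (hG : IsOpen G) (hV : ContDiffOn ℝ 1 V G) {f : ℝ → E} {T : ℝ}
    (hf : ContinuousOn f (Icc 0 T)) (hfG : ∀ s ∈ Icc 0 T, (s, f s) ∈ G) {η : ℝ} (hη : 0 < η) :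
    ∃ ρ > 0, ∀ s ∈ Icc 0 T, ∀ x ∈ ball (f s) ρ,
      ‖V (s, x) - V (s, f s) - spaceDeriv V (s, f s) (x - f s)‖ ≤ η * ‖x - f s‖ := by
  have hcov : ∀ p ∈ (fun s => (s, f s)) '' Icc 0 T, ∃ U : Set (ℝ × E), IsOpen U ∧ p ∈ U ∧
      ∀ y ∈ U, ∀ z ∈ U, ‖V y - V z - fderiv ℝ V z (y - z)‖ ≤ η * ‖y - z‖ := by
    rintro _ ⟨s, hs, rfl⟩
    set p := (s, f s) with hp
    have hpG : p ∈ G := hfG s hs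
    have h1 := (hV.contDiffAt (hG.mem_nhds hpG)).hasStrictFDerivAt (by norm_num)
    have h2 := (hasStrictFDerivAt_iff_isLittleO.1 h1).def (half_pos hη)
    have h3 : ∀ᶠ y in 𝓝 p, ‖fderiv ℝ V y - fderiv ℝ V p‖ < η / 2 := by
      have hc : ContinuousAt (fderiv ℝ V) p :=
        (hV.continuousOn_fderiv_of_isOpen hG le_rfl).continuousAt (hG.mem_nhds hpG)
      simpa [dist_eq_norm] using hc.eventually (ball_mem_nhds _ (half_pos hη))
    rw [nhds_prod_eq] at h2
    obtain ⟨S, hS, hS2⟩ := eventually_prod_self_iff'.1 h2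
    have h5 := interior_mem_nhds.2 (inter_mem (eventually_mem_set.1 hS) h3)
    refine ⟨interior (S ∩ {y | ‖fderiv ℝ V y - fderiv ℝ V p‖ < η / 2}), isOpen_interior,
      mem_of_mem_nhds h5, fun y hy z hz => ?_⟩
    have h6 := hS2 y (interior_subset hy).1 z (interior_subset hz).1
    have h7 : ‖fderiv ℝ V z - fderiv ℝ V p‖ < η / 2 := (interior_subset hz).2
    have h8 : V y - V z - fderiv ℝ V z (y - z) =
        (V y - V z - fderiv ℝ V p (y - z)) - (fderiv ℝ V z - fderiv ℝ V p) (y - z) := by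
      simp only [sub_apply]; abel
    rw [h8]
    calc _ ≤ η / 2 * ‖y - z‖ + η / 2 * ‖y - z‖ := by
          refine (norm_sub_le _ _).trans (add_le_add h6 ?_)
          refine (ContinuousLinearMap.le_opNorm _ _).trans ?_
          gcongr
      _ = η * ‖y - z‖ := by ring
  choose! U hUo hUm hU using hcov
  obtain ⟨ρ, hρ, hball⟩ := lebesgue_number_lemma_of_metric
    (ι := (fun s => (s, f s)) '' Icc 0 T) (c := fun i => U i)
    (isCompact_graph hf) (fun i => hUo i i.2) fun p hp => mem_iUnion.2 ⟨⟨p, hp⟩, hUm p hp⟩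
  refine ⟨ρ, hρ, fun s hs x hx => ?_⟩
  obtain ⟨⟨i, hi⟩, hsub⟩ := hball _ (mem_image_of_mem _ hs)
  have h1 : (s, x) ∈ U i := hsub (by rw [← ball_prod_same]; exact ⟨mem_ball_self hρ, hx⟩)
  have h2 : (s, f s) ∈ U i := hsub (mem_ball_self hρ)
  have h3 : ((s, x) - (s, f s) : ℝ × E) = (0, x - f s) := by simp
  have h := hU i hi _ h1 _ h2
  rw [h3] at h
  simpa [spaceDeriv, Prod.norm_def] using h

/-- Differentiability of the flow in the initial value; the derivative solves the linearized
equation. -/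
theorem exists_hasFDerivAt_maxSol [CompleteSpace E] (hG : IsOpen G) (hV : ContDiffOn ℝ 1 V G)
    {T : ℝ} (hT : 0 ≤ T) (hq : q ∈ survivalSet G V T) :
    ∃ Y : ℝ → E →L[ℝ] E, Y 0 = ContinuousLinearMap.id ℝ E ∧
      (∀ s ∈ Icc 0 T, HasDerivAt Y ((spaceDeriv V (s, maxSol G V q s)).comp (Y s)) s) ∧
      HasFDerivAt (fun q' => maxSol G V q' T) (Y T) q := by
  have hL := isLocLipField_of_contDiffOn hG hV
  have hs := hL.isODESolution_maxSol hq.1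
  have hsub := hL.Icc_subset_maxDom hq
  set Q := maxSol G V q with hQ
  set A : ℝ → E →L[ℝ] E := fun s => spaceDeriv V (s, Q s) with hA
  have hAc : ContinuousOn A (maxDom G V q) :=
    (continuousOn_spaceDeriv hG hV).comp (continuousOn_id.prodMk hs.continuousOn) hs.mem
  obtain ⟨Y, hY0, hY⟩ := exists_linear_solution
    (A := fun s => ContinuousLinearMap.compL ℝ E E E (A s)) hs.isOpen
    ((ContinuousLinearMap.compL ℝ E E E).continuous.comp_continuousOn hAc) hsub hs.zero_mem
    (ContinuousLinearMap.id ℝ E)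
  refine ⟨Y, hY0, hY, ?_⟩
  obtain ⟨δ, hδ, L, hL0, hdep⟩ := hL.exists_lipschitz_dependence hq.1 hT hsub
  obtain ⟨M, hM⟩ : ∃ M, ∀ s ∈ Icc 0 T, ‖A s‖ ≤ M :=
    isCompact_Icc.exists_bound_of_continuousOn (hAc.mono hsub)
  have hM0 : 0 ≤ M := (norm_nonneg _).trans (hM 0 ⟨le_rfl, hT⟩)
  -- The `+ 1` keeps `K` nonzero, so that the exponential form of `gronwallBound` applies.
  set K := M + 1 with hK
  have hKpos : 0 < K := by positivity
  set C : ℝ := L * ((Real.exp (K * T)) / K) with hC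
  have hC0 : 0 ≤ C := by positivity
  rw [hasFDerivAt_iff_isLittleO, Asymptotics.isLittleO_iff]
  intro c hc
  -- Gronwall will bound the error by `η * C * ‖w‖`, so this `η` brings it below `c * ‖w‖`.
  set η : ℝ := c / (C + 1) with hη
  have hη0 : 0 < η := by positivity
  obtain ⟨ρ, hρ, hlin⟩ := exists_uniform_linearization hG hV (hs.continuousOn.mono hsub)
    (fun s hs' => hs.mem s (hsub hs')) hη0
  have hev : ∀ᶠ q' in 𝓝 q, q' ∈ ball q δ ∧ L * ‖q' - q‖ < ρ := by
    refine (eventually_mem_set.2 (ball_mem_nhds q hδ)).and ?_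
    have : ContinuousAt (fun q' : E => L * ‖q' - q‖) q := by fun_prop
    exact this.eventually (gt_mem_nhds (by simpa using hρ))
  filter_upwards [hev] with q' ⟨hq'δ, hq'ρ⟩
  obtain ⟨hq'G, hsub', hdist⟩ := hdep q' hq'δ
  have hs' := hL.isODESolution_maxSol hq'G
  set Q' := maxSol G V q' with hQ'
  set w := q' - q with hw
  set e : ℝ → E := fun s => Q' s - Q s - Y s w with he
  set e' : ℝ → E := fun s => V (s, Q' s) - V (s, Q s) - (A s) (Y s w) with he'
  have hder : ∀ s ∈ Icc 0 T, HasDerivAt e (e' s) s := fun s hs0 =>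
    ((hs'.hasDerivAt s (hsub' hs0)).sub (hs.hasDerivAt s (hsub hs0))).sub
      (by simpa using (hY s hs0).clm_apply (hasDerivAt_const s w))
  have hbd : ∀ s ∈ Icc 0 T, ‖e' s‖ ≤ K * ‖e s‖ + η * (L * ‖w‖) := by
    intro s hs0
    have h1 := hdist s hs0
    have h2 := hlin s hs0 (Q' s) (by rw [mem_ball, dist_eq_norm]; exact h1.trans_lt hq'ρ)
    have h3 : e' s = (V (s, Q' s) - V (s, Q s) - A s (Q' s - Q s)) + A s (e s) := by
      simp only [he, he', map_sub]; abel
    rw [h3]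
    have h4 : ‖A s (e s)‖ ≤ K * ‖e s‖ :=
      ((A s).le_opNorm _).trans (by gcongr; linarith [hM s hs0])
    have h5 : η * ‖Q' s - Q s‖ ≤ η * (L * ‖w‖) := by gcongr
    linarith [norm_add_le (V (s, Q' s) - V (s, Q s) - A s (Q' s - Q s)) (A s (e s))]
  have hgr := norm_le_gronwallBound_of_norm_deriv_right_le (f := e) (f' := e') (δ := 0) (K := K)
    (ε := η * (L * ‖w‖)) (a := 0) (b := T)
    (fun s hs0 => (hder s hs0).continuousAt.continuousWithinAt)
    (fun s hs0 => (hder s (Ico_subset_Icc_self hs0)).hasDerivWithinAt)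
    (by
      have h1 : Q' 0 = q' := hs'.initial
      have h2 : Q 0 = q := hs.initial
      simp [he, h1, h2, hY0, hw])
    (fun s hs0 => hbd s (Ico_subset_Icc_self hs0)) T ⟨hT, le_rfl⟩
  simp only [gronwallBound_of_K_ne_0 hKpos.ne', sub_zero, zero_mul, zero_add] at hgr
  calc ‖e T‖ ≤ η * (L * ‖w‖) / K * (Real.exp (K * T) - 1) := hgr
    _ ≤ η * (L * ‖w‖) / K * Real.exp (K * T) := by gcongr; linarith
    _ = η * C * ‖w‖ := by rw [hC]; field_simp
    _ ≤ c * ‖w‖ := by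
      gcongr
      rw [hη, div_mul_eq_mul_div, div_le_iff₀ (by positivity)]
      nlinarith

end ODE

/-! ### Jacobi's formula, Liouville's formula and transport of the density. -/

section

theorem differentiable_matrix_det {n : Type*} [Fintype n] [DecidableEq n] :
    Differentiable ℝ (fun M : n → n → ℝ => (Matrix.of M).det) := by
  simp only [Matrix.det_apply, Matrix.of_apply]
  fun_prop

/-- The derivative of the determinant in the direction `N M` is read off from `det ((1 + r N) M) =
det (1 + r N) det M`, whose coefficient of `r` is `tr N · det M`. Invertibility of `M` is not
needed. -/
theorem hasDerivAt_matrix_det {n : Type*} [Fintype n] [DecidableEq n] {M : ℝ → n → n → ℝ}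
    {N : Matrix n n ℝ} {s : ℝ} (hM : HasDerivAt M (N * Matrix.of (M s) : Matrix n n ℝ) s) :
    HasDerivAt (fun s => (Matrix.of (M s)).det) (N.trace * (Matrix.of (M s)).det) s := by
  set F : (n → n → ℝ) → ℝ := fun M => (Matrix.of M).det with hF
  have h1 := (differentiable_matrix_det (n := n) (M s)).hasFDerivAt
  have h2 : HasDerivAt (fun s => F (M s)) (fderiv ℝ F (M s) (N * Matrix.of (M s) : Matrix n n ℝ))
    s := h1.comp_hasDerivAt s hM
  have h3 : fderiv ℝ F (M s) (N * Matrix.of (M s) : Matrix n n ℝ) =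
      N.trace * (Matrix.of (M s)).det := by
    set B : n → n → ℝ := (N * Matrix.of (M s) : Matrix n n ℝ) with hB
    have hline : HasDerivAt (fun r : ℝ => M s + r • B) B 0 := by
      simpa using ((hasDerivAt_id (0 : ℝ)).smul_const B).const_add (M s)
    have h1' : HasFDerivAt F (fderiv ℝ F (M s)) (M s + (0 : ℝ) • B) := by simpa using h1
    have h4 : HasDerivAt (fun r : ℝ => F (M s + r • B)) (fderiv ℝ F (M s) B) 0 :=
      h1'.comp_hasDerivAt (0 : ℝ) hline
    have h5 : (fun r : ℝ => F (M s + r • B)) =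
        fun r => (1 + N.trace * r + (Matrix.det (1 + (Polynomial.X : Polynomial ℝ) •
          N.map Polynomial.C)).divX.divX.eval r * r ^ 2) * (Matrix.of (M s)).det := by
      funext r
      rw [← Matrix.det_one_add_smul, ← Matrix.det_mul, add_mul, one_mul, Matrix.smul_mul]
      rfl
    set p := (Matrix.det (1 + (Polynomial.X : Polynomial ℝ) • N.map Polynomial.C)).divX.divX
    have h6 : HasDerivAt (fun r : ℝ => (1 + N.trace * r + p.eval r * r ^ 2) *
        (Matrix.of (M s)).det) (N.trace * (Matrix.of (M s)).det) 0 := by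
      have h7 := ((((hasDerivAt_id (0 : ℝ)).const_mul N.trace).const_add 1).add
        ((p.hasDerivAt 0).mul ((hasDerivAt_id (0 : ℝ)).pow 2))).mul_const (Matrix.of (M s)).det
      refine (h7.congr_deriv ?_).congr_of_eventuallyEq (Eventually.of_forall fun r => ?_)
      · simp
      · simp
    rw [h5] at h4
    exact h4.unique h6
  rwa [h3] at h2

/-- Jacobi's formula along solutions of `Y' = A Y`. -/
theorem hasDerivAt_det {d : ℕ} {Y : ℝ → Space d →L[ℝ] Space d} {A : Space d →L[ℝ] Space d} {s : ℝ}
    (hY : HasDerivAt Y (A.comp (Y s)) s) :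
    HasDerivAt (fun s => (Y s).det) (LinearMap.trace ℝ (Space d) A * (Y s).det) s := by
  set b := (EuclideanSpace.basisFun (Fin d) ℝ).toBasis with hb
  set Φ : (Space d →L[ℝ] Space d) →ₗ[ℝ] Matrix (Fin d) (Fin d) ℝ :=
    (LinearMap.toMatrix b b).toLinearMap.comp (ContinuousLinearMap.coeLM ℝ) with hΦ
  have hdet : ∀ T : Space d →L[ℝ] Space d, T.det = (Matrix.of (Φ T)).det := fun T =>
    (LinearMap.det_toMatrix b _).symm
  have hcomp : Φ (A.comp (Y s)) = LinearMap.toMatrix b b A * Φ (Y s) :=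
    LinearMap.toMatrix_comp b b b _ _
  let Ψ : (Space d →L[ℝ] Space d) →ₗ[ℝ] (Fin d → Fin d → ℝ) := Φ
  have h1 : HasDerivAt (fun s => Ψ (Y s)) (Ψ (A.comp (Y s))) s :=
    (LinearMap.toContinuousLinearMap Ψ).hasFDerivAt.comp_hasDerivAt s hY
  have h2 := hasDerivAt_matrix_det (M := fun s => Ψ (Y s)) (N := LinearMap.toMatrix b b A) (s := s)
    (by
      have : (LinearMap.toMatrix b b A * Matrix.of (Ψ (Y s)) : Matrix _ _ ℝ) = Ψ (A.comp (Y s)) :=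
        hcomp.symm
      rw [this]; exact h1)
  simp only [hdet]
  rw [LinearMap.trace_eq_matrix_trace ℝ b]
  exact h2

variable {d : ℕ} {conf : Set (Space d)} {j : SpaceTime d → SpaceTime d}

/-- The points of space-time over `conf` at which the current does not vanish. -/
def region (conf : Set (Space d)) (j : SpaceTime d → SpaceTime d) : Set (SpaceTime d) :=
  {p | p.2 ∈ conf ∧ j p ≠ 0}

/-- The velocity field `J / j⁰`. -/
def velocity (j : SpaceTime d → SpaceTime d) (p : SpaceTime d) : Space d :=
  (j p).1⁻¹ • (j p).2

theorem isODESolution_iff {q : Space d} {I : Set ℝ} {Q : ℝ → Space d} :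
    IsODESolution (region conf j) (velocity j) q I Q ↔ IsSolution conf j q I Q :=
  ⟨fun h => ⟨h.isOpen, h.ordConnected, h.zero_mem, h.initial, fun t ht => (h.mem t ht).1,
    fun t ht => (h.mem t ht).2, h.hasDerivAt⟩,
  fun h => ⟨h.isOpen, h.ordConnected, h.zero_mem, h.initial,
    fun t ht => ⟨h.mem_conf t ht, h.not_node t ht⟩, h.hasDerivAt⟩⟩

theorem isOpen_domain (hconf : IsOpen conf) : IsOpen (domain conf) :=
  hconf.preimage continuous_snd

theorem isOpen_region (hconf : IsOpen conf) (hj : IsCurrent conf j) : IsOpen (region conf j) :=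
  hj.contDiffOn.continuousOn.isOpen_inter_preimage (isOpen_domain hconf) isOpen_ne

theorem region_subset : region conf j ⊆ domain conf := fun _ hp => hp.1

theorem IsCurrent.pos (hj : IsCurrent conf j) {p : SpaceTime d} (hp : p ∈ region conf j) :
    0 < (j p).1 := hj.pos_of_ne_zero p hp.1 hp.2

theorem IsCurrent.nonneg (hj : IsCurrent conf j) {p : SpaceTime d} (hp : p ∈ domain conf) :
    0 ≤ (j p).1 := by
  by_cases h : j p = 0
  · simp [h]
  · exact (hj.pos_of_ne_zero p hp h).le

theorem contDiffOn_velocity (hj : IsCurrent conf j) :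
    ContDiffOn ℝ 1 (velocity j) (region conf j) := by
  have h := hj.contDiffOn.mono (region_subset (conf := conf) (j := j))
  exact (h.fst.inv fun p hp => (hj.pos hp).ne').smul h.snd

theorem isLocLipField_velocity (hconf : IsOpen conf) (hj : IsCurrent conf j) :
    IsLocLipField (region conf j) (velocity j) :=
  isLocLipField_of_contDiffOn (isOpen_region hconf hj) (contDiffOn_velocity hj)

/-- The continuity equation along trajectories. -/
theorem fderiv_density_velocity (hconf : IsOpen conf) (hj : IsCurrent conf j) {p : SpaceTime d}
    (hp : p ∈ region conf j) :
    fderiv ℝ (fun x => (j x).1) p (1, velocity j p) =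
      -(LinearMap.trace ℝ (Space d) (spaceDeriv (velocity j) p) * (j p).1) := by
  have hG := (isOpen_region hconf hj).mem_nhds hp
  have hV : DifferentiableAt ℝ (velocity j) p :=
    ((contDiffOn_velocity hj).contDiffAt hG).differentiableAt (by norm_num)
  have hj0 : DifferentiableAt ℝ (fun x => (j x).1) p :=
    ((hj.contDiffOn.contDiffAt ((isOpen_domain hconf).mem_nhds hp.1)).differentiableAt
      (by norm_num)).fst
  -- Near `p` one has `J_i = j⁰ V_i`, so the product rule turns the divergence into `∂_t j⁰ + j⁰
  -- tr(DV) + V · ∇j⁰`.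
  have hcomp : ∀ i : Fin d, fderiv ℝ (fun x => (j x).2 i) p (0, EuclideanSpace.single i 1) =
      (j p).1 * (spaceDeriv (velocity j) p (EuclideanSpace.single i 1)) i +
      velocity j p i * fderiv ℝ (fun x => (j x).1) p (0, EuclideanSpace.single i 1) := by
    intro i
    have heq : (fun x => (j x).2 i) =ᶠ[𝓝 p] fun x => (j x).1 * velocity j x i := by
      filter_upwards [hG] with x hx
      simp [velocity, mul_inv_cancel_left₀ (hj.pos hx).ne']
    have hVi : HasFDerivAt (fun x => velocity j x i)
        ((EuclideanSpace.proj (𝕜 := ℝ) i).comp (fderiv ℝ (velocity j) p)) p :=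
      (EuclideanSpace.proj (𝕜 := ℝ) i).hasFDerivAt.comp p hV.hasFDerivAt
    rw [heq.fderiv_eq, (hj0.hasFDerivAt.fun_mul hVi).fderiv]
    simp [spaceDeriv]
  have hdiv := hj.divergence_eq_zero p hp.1
  rw [divergence] at hdiv
  simp only [hcomp, Finset.sum_add_distrib, ← Finset.mul_sum] at hdiv
  have htr : LinearMap.trace ℝ (Space d) (spaceDeriv (velocity j) p) =
      ∑ i, (spaceDeriv (velocity j) p (EuclideanSpace.single i 1)) i := by
    rw [LinearMap.trace_eq_sum_inner _ (EuclideanSpace.basisFun (Fin d) ℝ)]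
    simp [EuclideanSpace.inner_single_left]
  have hvec : ((1, velocity j p) : SpaceTime d) = (1, 0) +
      ∑ i, velocity j p i • ((0, EuclideanSpace.single i 1) : SpaceTime d) := by
    ext k
    · simp [Prod.fst_sum]
    · simp [Prod.snd_sum, Finset.sum_apply, Pi.single_apply]
  rw [hvec, map_add, map_sum, htr]
  simp only [map_smul, smul_eq_mul]
  linarith

/-- Liouville's formula: the flow transports the density. -/
theorem exists_fderiv_flow (hconf : IsOpen conf) (hj : IsCurrent conf j) {t : ℝ} (ht : 0 ≤ t)
    {q : Space d} (hq : q ∈ survivalSet (region conf j) (velocity j) t) :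
    ∃ Y : Space d →L[ℝ] Space d,
      HasFDerivAt (fun q' => maxSol (region conf j) (velocity j) q' t) Y q ∧
      (j (t, maxSol (region conf j) (velocity j) q t)).1 * Y.det = (j (0, q)).1 := by
  have hL := isLocLipField_velocity hconf hj
  have hs := hL.isODESolution_maxSol hq.1
  have hsub := hL.Icc_subset_maxDom hq
  obtain ⟨Y, hY0, hY, hYt⟩ := exists_hasFDerivAt_maxSol (isOpen_region hconf hj)
    (contDiffOn_velocity hj) ht hq
  refine ⟨Y t, hYt, ?_⟩
  set Q := maxSol (region conf j) (velocity j) q with hQ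
  -- The continuity equation contributes `-tr(DV) j⁰ det Y` and Jacobi's formula the opposite term.
  have hder : ∀ s ∈ Icc 0 t, HasDerivAt (fun s => (j (s, Q s)).1 * (Y s).det) 0 s := by
    intro s hs0
    have hG := hs.mem s (hsub hs0)
    have hj0 : DifferentiableAt ℝ (fun x => (j x).1) (s, Q s) :=
      ((hj.contDiffOn.contDiffAt ((isOpen_domain hconf).mem_nhds hG.1)).differentiableAt
        (by norm_num)).fst
    have h1 : HasDerivAt (fun s => (j (s, Q s)).1)
        (fderiv ℝ (fun x => (j x).1) (s, Q s) (1, velocity j (s, Q s))) s :=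
      HasFDerivAt.comp_hasDerivAt (l := fun x => (j x).1) (f := fun s => (s, Q s)) s
        hj0.hasFDerivAt ((hasDerivAt_id s).prodMk (hs.hasDerivAt s (hsub hs0)))
    refine (h1.mul (hasDerivAt_det (hY s hs0))).congr_deriv ?_
    rw [fderiv_density_velocity hconf hj hG]
    ring
  have hconst := constant_of_has_deriv_right_zero
    (fun s hs0 => (hder s hs0).continuousAt.continuousWithinAt)
    (fun s hs0 => (hder s (Ico_subset_Icc_self hs0)).hasDerivWithinAt) t ⟨ht, le_rfl⟩
  have hQ0 : Q 0 = q := hs.initial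
  rw [hconst, hQ0, hY0]
  simp [ContinuousLinearMap.det]

theorem survivalSet_subset (t : ℝ) : survivalSet (region conf j) (velocity j) t ⊆ conf :=
  fun _ hq => hq.1.1

/-- The part of the distribution that survives until time `t ≥ 0` is dominated by `μ_t`. -/
theorem lintegral_flow_le (hconf : IsOpen conf) (hj : IsCurrent conf j) {t : ℝ} (ht : 0 ≤ t)
    (f : Space d → ℝ≥0∞) :
    ∫⁻ q in survivalSet (region conf j) (velocity j) t,
      ENNReal.ofReal (j (0, q)).1 * f (maxSol (region conf j) (velocity j) q t) ≤
    ∫⁻ y in conf, ENNReal.ofReal (j (t, y)).1 * f y := by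
  set D := survivalSet (region conf j) (velocity j) t with hD
  set Φ : Space d → Space d := fun q => maxSol (region conf j) (velocity j) q t with hΦ
  have hL := isLocLipField_velocity hconf hj
  have hDm : MeasurableSet D := (hL.isOpen_survivalSet ht).measurableSet
  choose! Y hY hYdet using fun q (hq : q ∈ D) => exists_fderiv_flow hconf hj ht hq
  have hmem : ∀ q ∈ D, (t, Φ q) ∈ region conf j := fun q hq =>
    (hL.isODESolution_maxSol hq.1).mem t hq.2
  have himg : Φ '' D ⊆ conf := by
    rintro _ ⟨q, hq, rfl⟩
    exact (hmem q hq).1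
  calc _ = ∫⁻ q in D, ENNReal.ofReal |(Y q).det| *
        (ENNReal.ofReal (j (t, Φ q)).1 * f (Φ q)) := by
        refine setLIntegral_congr_fun hDm fun q hq => ?_
        have h1 : 0 < (j (t, Φ q)).1 := hj.pos (hmem q hq)
        have h2 : |(Y q).det| * (j (t, Φ q)).1 = (j (0, q)).1 := by
          have h3 := hj.pos hq.1
          rw [← hYdet q hq, ← abs_of_pos h1, mul_comm, ← abs_mul, abs_of_pos h1, abs_of_pos]
          rw [hYdet q hq]; exact h3
        rw [← mul_assoc, ← ENNReal.ofReal_mul (abs_nonneg _), h2]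
    _ = ∫⁻ y in Φ '' D, ENNReal.ofReal (j (t, y)).1 * f y :=
        (lintegral_image_eq_lintegral_abs_det_fderiv_mul volume hDm
          (fun q hq => (hY q hq).hasFDerivWithinAt) (hL.injOn_maxSol t)
          (fun y => ENNReal.ofReal (j (t, y)).1 * f y)).symm
    _ ≤ _ := lintegral_mono_set himg

end

/-! ### Local integrability of the inverse distance in codimension at least two. -/

section

theorem integrable_indicator_abs_rpow {r : ℝ} (hr : -1 < r) {R : ℝ} (hR : 0 ≤ R) :
    Integrable ((Icc (-R) R).indicator fun x : ℝ => |x| ^ r) := by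
  rw [integrable_indicator_iff measurableSet_Icc]
  have h1 : IntervalIntegrable (fun x : ℝ => |x| ^ r) volume 0 R := by
    refine (intervalIntegral.intervalIntegrable_rpow' (a := 0) (b := R) hr).congr ?_
    intro x hx
    rw [uIoc_of_le hR] at hx
    simp only
    rw [abs_of_pos hx.1]
  have h2 : IntervalIntegrable (fun x : ℝ => |x| ^ r) volume (-R) 0 := by
    simpa using ((IntervalIntegrable.iff_comp_neg (by finiteness)).1 h1).symm
  have h3 := h2.trans h1
  rwa [intervalIntegrable_iff_integrableOn_Icc_of_le (by linarith)] at h3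

/-- The inverse distance to a subspace of codimension at least two is locally integrable. -/
theorem lintegral_inv_norm_starProjection_lt_top {d : ℕ} (W : Submodule ℝ (Space d))
    (hW : 2 ≤ Module.finrank ℝ W) {R : ℝ} (hR : 0 ≤ R) :
    ∫⁻ x in closedBall (0 : Space d) R, ENNReal.ofReal ‖W.starProjection x‖⁻¹ < ⊤ := by
  have hd : 2 ≤ d := hW.trans (by simpa using Submodule.finrank_le W)
  obtain ⟨n, rfl⟩ : ∃ n, d = n + 2 := ⟨d - 2, by omega⟩
  set bW := stdOrthonormalBasis ℝ W with hbW
  -- Two orthonormal vectors of `W`, to be completed to an orthonormal basis `b` of the whole space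
  -- with `b 0` and `b 1` in `W`.
  set v : Fin (n + 2) → Space (n + 2) := fun i =>
    if h : i.1 < 2 then (bW ⟨i.1, h.trans_le hW⟩ : Space (n + 2)) else 0 with hv
  obtain ⟨b, hb⟩ := Orthonormal.exists_orthonormalBasis_extension_of_card_eq (𝕜 := ℝ)
    (ι := Fin (n + 2)) (by simp) (v := v) (s := {i | i.1 < 2}) (by
      have h1 : Orthonormal ℝ (fun i : {i : Fin (n + 2) | i.1 < 2} =>
          (bW ⟨i.1.1, lt_of_lt_of_le i.2 hW⟩ : Space (n + 2))) := by
        refine (bW.orthonormal.comp (fun i : {i : Fin (n + 2) | i.1 < 2} =>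
          (⟨i.1.1, lt_of_lt_of_le i.2 hW⟩ : Fin _)) ?_).comp_linearIsometry W.subtypeₗᵢ
        intro i k hik
        exact Subtype.ext (Fin.ext (by simpa using hik))
      have h2 : ({i : Fin (n + 2) | i.1 < 2} : Set (Fin (n + 2))).domRestrict v =
          fun i => (bW ⟨i.1.1, lt_of_lt_of_le i.2 hW⟩ : Space (n + 2)) :=
        funext fun i => dif_pos i.2
      rw [h2]
      exact h1)
  have hbmem : ∀ i : Fin (n + 2), i.1 < 2 → b i ∈ W := by
    intro i hi
    rw [hb i hi, hv]
    simp only [dif_pos hi]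
    exact Subtype.coe_prop _
  have hcoord : ∀ (x : Space (n + 2)) (i : Fin (n + 2)), i.1 < 2 →
      |(b.repr x) i| ≤ ‖W.starProjection x‖ := by
    intro x i hi
    rw [b.repr_apply_apply, ← Submodule.starProjection_eq_self_iff.2 (hbmem i hi),
      Submodule.inner_starProjection_left_eq_right]
    refine (abs_real_inner_le_norm _ _).trans ?_
    simp
  have hcoordR : ∀ x ∈ closedBall (0 : Space (n + 2)) R, ∀ i, (b.repr x) i ∈ Icc (-R) R := by
    intro x hx i
    rw [mem_Icc, ← abs_le, b.repr_apply_apply]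
    refine (abs_real_inner_le_norm _ _).trans ?_
    simpa using hx
  -- Splitting `‖Px‖⁻¹` into two factors `‖Px‖ ^ (-1/2)` bounds it by `|x₀| ^ (-1/2) |x₁| ^ (-1/2)`,
  -- a product of integrable functions of one variable since `-1/2 > -1`.
  set f : Fin (n + 2) → ℝ → ℝ := fun i =>
    (Icc (-R) R).indicator fun x => |x| ^ (if i.1 < 2 then (-1 / 2 : ℝ) else 0) with hf
  have hint : Integrable (fun y : Fin (n + 2) → ℝ => ∏ i, f i (y i)) :=
    Integrable.fintype_prod fun i => by
      refine integrable_indicator_abs_rpow ?_ hR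
      split_ifs <;> norm_num
  have hmp : MeasurePreserving (fun x : Space (n + 2) => (WithLp.ofLp (b.repr x) :
      Fin (n + 2) → ℝ)) :=
    (PiLp.volume_preserving_ofLp (Fin (n + 2))).comp b.measurePreserving_repr
  have hint' := (hmp.integrable_comp hint.aestronglyMeasurable).2 hint
  -- Since `0 ^ (-1/2) = 0` for real powers, the bound can fail where a coordinate vanishes; these
  -- points form a null set.
  have hne : ∀ i : Fin (n + 2), ∀ᵐ x : Space (n + 2), (b.repr x) i ≠ 0 := by
    intro i
    have h1 : ∀ᵐ y : Fin (n + 2) → ℝ, y i ≠ 0 :=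
      (Measure.quasiMeasurePreserving_eval (fun _ : Fin (n + 2) => (volume : Measure ℝ)) i).ae
        (Measure.ae_ne volume 0)
    exact hmp.quasiMeasurePreserving.ae h1
  refine lt_of_le_of_lt ?_ hint'.lintegral_lt_top
  refine (lintegral_mono_ae ?_).trans (setLIntegral_le_lintegral (closedBall 0 R) _)
  filter_upwards [ae_restrict_mem measurableSet_closedBall, ae_restrict_of_ae (hne 0),
    ae_restrict_of_ae (hne 1)] with x hx h0 h1
  refine ENNReal.ofReal_le_ofReal ?_
  simp only [Function.comp_apply, hf]
  rw [Finset.prod_congr rfl fun i _ => indicator_of_mem (hcoordR x hx i) _,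
    Fin.prod_univ_succ, Fin.prod_univ_succ]
  have h2 : ∀ i : Fin n, ¬ (i.succ.succ : Fin (n + 2)).1 < 2 := fun i => by simp
  simp only [h2, if_false, Real.rpow_zero, Finset.prod_const_one, mul_one]
  have e0 : (((0 : Fin (n + 2)).1 < 2)) := by simp
  have e1 : (((Fin.succ 0 : Fin (n + 2)).1 < 2)) := by simp
  rw [if_pos e0, if_pos e1]
  have key : ∀ i : Fin (n + 2), i.1 < 2 → (b.repr x) i ≠ 0 →
      ‖W.starProjection x‖ ^ (-1 / 2 : ℝ) ≤ |(b.repr x) i| ^ (-1 / 2 : ℝ) := fun i hi hne =>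
    Real.rpow_le_rpow_of_nonpos (abs_pos.2 hne) (hcoord x i hi) (by norm_num)
  have hpos : 0 < ‖W.starProjection x‖ := (abs_pos.2 h0).trans_le (hcoord x 0 e0)
  calc ‖W.starProjection x‖⁻¹
      = ‖W.starProjection x‖ ^ (-1 / 2 : ℝ) * ‖W.starProjection x‖ ^ (-1 / 2 : ℝ) := by
        rw [← Real.rpow_add hpos, ← Real.rpow_neg_one]; norm_num
    _ ≤ _ := mul_le_mul (key 0 e0 h0) (key _ e1 h1) (by positivity) (by positivity)

theorem lintegral_inv_norm_starProjection_sub_lt_top {d : ℕ} (W : Submodule ℝ (Space d))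
    (hW : 2 ≤ Module.finrank ℝ W) (R : ℝ) (s : Space d) :
    ∫⁻ x in closedBall (0 : Space d) R, ENNReal.ofReal ‖W.starProjection (x - s)‖⁻¹ < ⊤ := by
  refine lt_of_le_of_lt ?_ (lintegral_inv_norm_starProjection_lt_top W hW
    (R := |R| + ‖s‖) (by positivity))
  rw [← lintegral_indicator measurableSet_closedBall, ← lintegral_indicator measurableSet_closedBall,
    ← lintegral_sub_right_eq_self
      ((closedBall 0 (|R| + ‖s‖)).indicator fun x => ENNReal.ofReal ‖W.starProjection x‖⁻¹) s]
  refine lintegral_mono fun x => ?_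
  by_cases hx : x ∈ closedBall (0 : Space d) R
  · have hx' : x - s ∈ closedBall (0 : Space d) (|R| + ‖s‖) := by
      rw [mem_closedBall_zero_iff] at hx ⊢
      exact (norm_sub_le _ _).trans (by gcongr; exact hx.trans (le_abs_self R))
    rw [indicator_of_mem hx, indicator_of_mem hx']
  · simp [indicator_of_notMem hx]

end

/-! ### Almost sure survival for all positive times. -/

section

/-- A positive function whose logarithmic derivative has finite integral stays away from zero. -/
theorem exists_pos_lower_bound {f f' h : ℝ → ℝ} {b : ℝ}
    (hf : ∀ t ∈ Ico 0 b, HasDerivAt f (f' t) t) (hpos : ∀ t ∈ Ico 0 b, 0 < f t)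
    (hle : ∀ t ∈ Ico 0 b, |f' t| ≤ h t * f t) (hc : ContinuousOn h (Ico 0 b))
    (hM : ∫⁻ t in Ioo 0 b, ENNReal.ofReal (h t) ≠ ⊤) :
    ∃ ε > 0, ∀ t ∈ Ico 0 b, ε ≤ f t := by
  set M := (∫⁻ t in Ioo 0 b, ENNReal.ofReal (h t)).toReal with hMdef
  have hnn : ∀ t ∈ Ico 0 b, 0 ≤ h t := fun t ht =>
    nonneg_of_mul_nonneg_left ((abs_nonneg _).trans (hle t ht)) (hpos t ht)
  -- The derivative of `-log f` is at most `h`, so `-log f` grows by at most `M`.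
  refine ⟨Real.exp (Real.log (f 0) - M), Real.exp_pos _, fun t ht => ?_⟩
  have hsub : Icc 0 t ⊆ Ico 0 b := fun s hs => ⟨hs.1, hs.2.trans_lt ht.2⟩
  have hder : ∀ s ∈ Icc 0 t, HasDerivAt (fun s => -Real.log (f s)) (-(f' s / f s)) s :=
    fun s hs => ((hf s (hsub hs)).log (hpos s (hsub hs)).ne').neg
  have h1 := intervalIntegral.sub_le_integral_of_hasDeriv_right_of_le
    (g := fun s => -Real.log (f s)) (g' := fun s => -(f' s / f s)) (φ := h) ht.1
    (fun s hs => (hder s hs).continuousAt.continuousWithinAt)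
    (fun s hs => (hder s (Ioo_subset_Icc_self hs)).hasDerivWithinAt)
    ((hc.mono hsub).integrableOn_Icc) (fun s hs => by
      have hs' := hsub (Ioo_subset_Icc_self hs)
      rw [← neg_div, div_le_iff₀ (hpos s hs')]
      exact (neg_le_abs _).trans (hle s hs'))
  have h2 : ∫ s in (0 : ℝ)..t, h s ≤ M := by
    rw [intervalIntegral.integral_of_le ht.1, integral_eq_lintegral_of_nonneg_ae]
    · exact ENNReal.toReal_mono hM (lintegral_mono_set fun s hs => ⟨hs.1, hs.2.trans_lt ht.2⟩)
    · filter_upwards [ae_restrict_mem measurableSet_Ioc] with s hs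
      exact hnn s (hsub (Ioc_subset_Icc_self hs))
    · exact ((hc.mono hsub).mono Ioc_subset_Icc_self).aestronglyMeasurable measurableSet_Ioc
  rw [← Real.exp_log (hpos t ht)]
  gcongr
  linarith

variable {d m : ℕ} {S : Fin m → AffineSubspace ℝ (Space d)} {j : SpaceTime d → SpaceTime d} {c : ℝ}

theorem isOpen_configSpace (S : Fin m → AffineSubspace ℝ (Space d)) : IsOpen (configSpace S) :=
  (isClosed_iUnion_of_finite fun l => (S l).closed_of_finiteDimensional).isOpen_compl

/-- The component of `x - s` orthogonal to the affine subspace `S`, for a base point `s` of `S`. -/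
def normalPart (S : AffineSubspace ℝ (Space d)) (s x : Space d) : Space d :=
  S.directionᗮ.starProjection (x - s)

theorem continuous_normalPart (S : AffineSubspace ℝ (Space d)) (s : Space d) :
    Continuous (normalPart S s) := by
  unfold normalPart; fun_prop

theorem normalPart_eq_zero_iff {S : AffineSubspace ℝ (Space d)} {s x : Space d} (hs : s ∈ S) :
    normalPart S s x = 0 ↔ x ∈ S := by
  rw [normalPart, Submodule.starProjection_apply_eq_zero_iff, Submodule.orthogonal_orthogonal,
    ← vsub_eq_sub, AffineSubspace.vsub_right_mem_direction_iff_mem hs]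

theorem mem_configSpace_iff {s : Fin m → Space d} (hs : ∀ l, s l ∈ S l) {x : Space d} :
    x ∈ configSpace S ↔ ∀ l, normalPart (S l) (s l) x ≠ 0 := by
  simp only [configSpace, mem_compl_iff, mem_iUnion, not_exists, ne_eq,
    normalPart_eq_zero_iff (hs _), SetLike.mem_coe]

/-- Projection does not increase the norm of the velocity. The square of the distance is taken
because it is differentiable even where the distance vanishes. -/
theorem hasDerivAt_norm_sq_normalPart (S : AffineSubspace ℝ (Space d)) (s : Space d)
    {Q : ℝ → Space d} {v : Space d} {t : ℝ} (hQ : HasDerivAt Q v t) :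
    ∃ D, HasDerivAt (fun t => ‖normalPart S s (Q t)‖ ^ 2) D t ∧
      |D| ≤ 2 * ‖v‖ * ‖normalPart S s (Q t)‖ := by
  have h1 : HasDerivAt (fun t => normalPart S s (Q t)) (S.directionᗮ.starProjection v) t :=
    S.directionᗮ.starProjection.hasFDerivAt.comp_hasDerivAt t (hQ.sub_const s)
  refine ⟨_, h1.norm_sq, ?_⟩
  rw [abs_mul, abs_two]
  have h2 := abs_real_inner_le_norm (normalPart S s (Q t)) (S.directionᗮ.starProjection v)
  have h3 : ‖S.directionᗮ.starProjection v‖ ≤ ‖v‖ := Submodule.norm_starProjection_apply_le _ _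
  nlinarith [norm_nonneg (normalPart S s (Q t))]

/-- A bound for the logarithmic derivatives, along trajectories, of the density and of the
squared distances to the excluded subspaces. -/
def logRate (S : Fin m → AffineSubspace ℝ (Space d)) (s : Fin m → Space d)
    (j : SpaceTime d → SpaceTime d) (c : ℝ) (p : SpaceTime d) : ℝ :=
  -- Under the bound on `J`, `1 + |c|` bounds the norm of the space-time velocity `(1, J / j⁰)`.
  ‖fderiv ℝ (fun x => (j x).1) p‖ * (1 + |c|) * (j p).1⁻¹ +
    ∑ l, 2 * ‖velocity j p‖ * ‖normalPart (S l) (s l) p.2‖⁻¹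

theorem continuousOn_fderiv_density {conf : Set (Space d)} (hconf : IsOpen conf)
    (hj : IsCurrent conf j) : ContinuousOn (fderiv ℝ (fun x => (j x).1)) (domain conf) :=
  hj.contDiffOn.fst.continuousOn_fderiv_of_isOpen (isOpen_domain hconf) le_rfl

theorem continuousOn_logRate {s : Fin m → Space d} (hs : ∀ l, s l ∈ S l)
    (hj : IsCurrent (configSpace S) j) :
    ContinuousOn (logRate S s j c) (region (configSpace S) j) := by
  have h1 := (continuousOn_fderiv_density (isOpen_configSpace S) hj).mono
    (region_subset (j := j))
  have h2 : ContinuousOn (fun p => (j p).1) (region (configSpace S) j) :=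
    (hj.contDiffOn.continuousOn.mono (region_subset (j := j))).fst
  refine ((h1.norm.mul continuousOn_const).mul (h2.inv₀ fun p hp => (hj.pos hp).ne')).add ?_
  refine continuousOn_finsetSum _ fun l _ => ?_
  refine ((continuousOn_const.mul (contDiffOn_velocity hj).continuousOn.norm)).mul ?_
  refine ContinuousOn.inv₀ ?_ fun p hp => norm_ne_zero_iff.2 ((mem_configSpace_iff hs).1 hp.1 l)
  exact ((continuous_normalPart (S l) (s l)).comp continuous_snd).norm.continuousOn

theorem norm_velocity_le (hj : IsCurrent (configSpace S) j)
    (hc : ∀ p ∈ domain (configSpace S), ‖(j p).2‖ ≤ c * (j p).1) {p : SpaceTime d}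
    (hp : p ∈ region (configSpace S) j) : ‖velocity j p‖ ≤ |c| := by
  have h1 := hj.pos hp
  rw [velocity, norm_smul, norm_inv, Real.norm_of_nonneg h1.le, inv_mul_le_iff₀ h1, mul_comm]
  exact (hc p hp.1).trans (by gcongr; exact le_abs_self c)

/-- If the logarithmic rate is integrable along a trajectory then the trajectory does not end. -/
theorem not_exit {s : Fin m → Space d} (hs : ∀ l, s l ∈ S l)
    (hj : IsCurrent (configSpace S) j)
    (hc : ∀ p ∈ domain (configSpace S), ‖(j p).2‖ ≤ c * (j p).1) {q : Space d}
    (hq : (0, q) ∈ region (configSpace S) j) {b : ℝ} (hb : 0 < b)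
    (hbI : b ∉ maxDom (region (configSpace S) j) (velocity j) q)
    (hsub : Ico 0 b ⊆ maxDom (region (configSpace S) j) (velocity j) q)
    (hM : ∫⁻ t in Ioo 0 b, ENNReal.ofReal (logRate S s j c
      (t, maxSol (region (configSpace S) j) (velocity j) q t)) ≠ ⊤) : False := by
  have hconf := isOpen_configSpace S
  have hL := isLocLipField_velocity hconf hj
  have hsol := hL.isODESolution_maxSol hq
  obtain ⟨x, hx, hxG⟩ := hL.exists_limit hq hb hbI hsub (M := |c|)
    fun t ht => norm_velocity_le hj hc (hsol.mem t (hsub ht))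
  set Q := maxSol (region (configSpace S) j) (velocity j) q with hQ
  have hmem : ∀ t ∈ Ico 0 b, (t, Q t) ∈ region (configSpace S) j := fun t ht =>
    hsol.mem t (hsub ht)
  have hder : ∀ t ∈ Ico 0 b, HasDerivAt Q (velocity j (t, Q t)) t := fun t ht =>
    hsol.hasDerivAt t (hsub ht)
  have hrc : ContinuousOn (fun t => logRate S s j c (t, Q t)) (Ico 0 b) :=
    (continuousOn_logRate hs hj).comp
      (continuousOn_id.prodMk (hsol.continuousOn.mono hsub)) hmem
  have hterm : ∀ p ∈ region (configSpace S) j, ∀ l,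
      0 ≤ 2 * ‖velocity j p‖ * ‖normalPart (S l) (s l) p.2‖⁻¹ := fun p _ l => by positivity
  have hterm0 : ∀ p ∈ region (configSpace S) j,
      0 ≤ ‖fderiv ℝ (fun x => (j x).1) p‖ * (1 + |c|) * (j p).1⁻¹ := fun p hp => by
    have := hj.pos hp
    positivity
  have hb0 : ∀ᶠ t in 𝓝[<] b, t ∈ Ico 0 b := by
    filter_upwards [Ioo_mem_nhdsLT hb] with t ht using Ioo_subset_Ico_self ht
  -- The squared distance to each subspace stays above a positive constant, hence so does its limit
  -- at `x`.
  have hxconf : x ∈ configSpace S := by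
    rw [mem_configSpace_iff hs]
    intro l hl
    have hn0 : ∀ t ∈ Ico 0 b, 0 < ‖normalPart (S l) (s l) (Q t)‖ := fun t ht =>
      norm_pos_iff.2 ((mem_configSpace_iff hs).1 (hmem t ht).1 l)
    choose! D hD hDle using fun t (ht : t ∈ Ico 0 b) =>
      hasDerivAt_norm_sq_normalPart (S l) (s l) (hder t ht)
    obtain ⟨ε, hε, hlow⟩ := exists_pos_lower_bound hD (fun t ht => by
      have := hn0 t ht
      positivity) (fun t ht => (hDle t ht).trans (by
        have h1 : 2 * ‖velocity j (t, Q t)‖ * ‖normalPart (S l) (s l) (Q t)‖⁻¹ ≤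
            logRate S s j c (t, Q t) := by
          have h2 := Finset.single_le_sum
            (f := fun l => 2 * ‖velocity j (t, Q t)‖ * ‖normalPart (S l) (s l) (Q t)‖⁻¹)
            (fun l _ => hterm _ (hmem t ht) l) (Finset.mem_univ l)
          have h3 := hterm0 _ (hmem t ht)
          simp only [logRate]
          linarith
        have h4 := hn0 t ht
        calc 2 * ‖velocity j (t, Q t)‖ * ‖normalPart (S l) (s l) (Q t)‖
            = 2 * ‖velocity j (t, Q t)‖ * ‖normalPart (S l) (s l) (Q t)‖⁻¹ *
              ‖normalPart (S l) (s l) (Q t)‖ ^ 2 := by field_simp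
          _ ≤ _ := by gcongr)) hrc hM
    have hlim : Tendsto (fun t => ‖normalPart (S l) (s l) (Q t)‖ ^ 2) (𝓝[<] b)
        (𝓝 (‖normalPart (S l) (s l) x‖ ^ 2)) :=
      (((continuous_normalPart (S l) (s l)).norm.pow 2).tendsto x).comp hx
    have := ge_of_tendsto hlim (hb0.mono hlow)
    rw [hl] at this
    simp at this
    linarith
  have hxd : ((b, x) : SpaceTime d) ∈ domain (configSpace S) := hxconf
  have hj0 : ∀ t ∈ Ico 0 b, DifferentiableAt ℝ (fun x => (j x).1) (t, Q t) := fun t ht =>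
    ((hj.contDiffOn.contDiffAt ((isOpen_domain hconf).mem_nhds (hmem t ht).1)).differentiableAt
      (by norm_num)).fst
  -- The same argument for `j⁰` excludes that `(b, x)` is a node; `(b, x)` then lies in the region
  -- after all.
  obtain ⟨ε, hε, hlow⟩ := exists_pos_lower_bound (f := fun t => (j (t, Q t)).1)
    (fun t ht => HasFDerivAt.comp_hasDerivAt (l := fun x => (j x).1) (f := fun s => (s, Q s)) t
      (hj0 t ht).hasFDerivAt ((hasDerivAt_id t).prodMk (hder t ht)))
    (fun t ht => hj.pos (hmem t ht)) (fun t ht => by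
      have hpos := hj.pos (hmem t ht)
      have h1 : ‖fderiv ℝ (fun x => (j x).1) (t, Q t)‖ * (1 + |c|) * (j (t, Q t)).1⁻¹ ≤
          logRate S s j c (t, Q t) :=
        le_add_of_nonneg_right (Finset.sum_nonneg fun l _ => hterm _ (hmem t ht) l)
      have h2 : ‖((1, velocity j (t, Q t)) : SpaceTime d)‖ ≤ 1 + |c| := by
        rw [Prod.norm_def]
        refine max_le (by simp) ?_
        linarith [norm_velocity_le hj hc (hmem t ht)]
      rw [← Real.norm_eq_abs]
      calc _ ≤ ‖fderiv ℝ (fun x => (j x).1) (t, Q t)‖ * (1 + |c|) :=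
            (ContinuousLinearMap.le_opNorm _ _).trans (by gcongr)
        _ = ‖fderiv ℝ (fun x => (j x).1) (t, Q t)‖ * (1 + |c|) * (j (t, Q t)).1⁻¹ *
              (j (t, Q t)).1 := by field_simp
        _ ≤ _ := by gcongr) hrc hM
  have hlim : Tendsto (fun t => (j (t, Q t)).1) (𝓝[<] b) (𝓝 (j (b, x)).1) := by
    have h1 : ContinuousAt (fun p => (j p).1) (b, x) :=
      (hj.contDiffOn.continuousOn.continuousAt ((isOpen_domain hconf).mem_nhds hxd)).fst
    exact h1.tendsto.comp ((tendsto_id.mono_left nhdsWithin_le_nhds).prodMk_nhds hx)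
  have hge : ε ≤ (j (b, x)).1 := ge_of_tendsto hlim (hb0.mono hlow)
  refine hxG ⟨hxconf, fun h0 => ?_⟩
  rw [h0] at hge
  exact absurd hge (not_le.2 hε)

/-- The weight `j⁰` cancels the inverse density and turns the velocity into `J`, so local bounds on
`J` and on the derivative of `j⁰` suffice. At nodes the weight is 0. -/
theorem density_mul_logRate_le {s : Fin m → Space d} (hj : IsCurrent (configSpace S) j)
    {p : SpaceTime d} (hp : p ∈ domain (configSpace S)) {C₁ C₂ : ℝ} (hC₁ : 0 ≤ C₁) (hC₂ : 0 ≤ C₂)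
    (h1 : ‖fderiv ℝ (fun x => (j x).1) p‖ ≤ C₁) (h2 : ‖(j p).2‖ ≤ C₂) :
    ENNReal.ofReal (j p).1 * ENNReal.ofReal (logRate S s j c p) ≤
      ENNReal.ofReal (C₁ * (1 + |c|)) +
        ∑ l, ENNReal.ofReal (2 * C₂) * ENNReal.ofReal ‖normalPart (S l) (s l) p.2‖⁻¹ := by
  by_cases h0 : j p = 0
  · simp [h0]
  have hpos := hj.pos_of_ne_zero p hp h0
  have h3 : (j p).1 * logRate S s j c p = ‖fderiv ℝ (fun x => (j x).1) p‖ * (1 + |c|) +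
      ∑ l, 2 * ‖(j p).2‖ * ‖normalPart (S l) (s l) p.2‖⁻¹ := by
    have hv : ‖velocity j p‖ = (j p).1⁻¹ * ‖(j p).2‖ := by
      rw [velocity, norm_smul, norm_inv, Real.norm_of_nonneg hpos.le]
    rw [logRate, mul_add, Finset.mul_sum, hv]
    congr 1
    · field_simp
    · refine Finset.sum_congr rfl fun l _ => ?_
      field_simp
  rw [← ENNReal.ofReal_mul hpos.le, h3]
  have h4 : ∀ l, ENNReal.ofReal (2 * C₂) * ENNReal.ofReal ‖normalPart (S l) (s l) p.2‖⁻¹ =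
      ENNReal.ofReal (2 * C₂ * ‖normalPart (S l) (s l) p.2‖⁻¹) := fun l =>
    (ENNReal.ofReal_mul (by positivity)).symm
  simp only [h4]
  rw [← ENNReal.ofReal_sum_of_nonneg (fun l _ => by positivity),
    ← ENNReal.ofReal_add (by positivity) (Finset.sum_nonneg fun l _ => by positivity)]
  gcongr

/-- The integral of the rate over a ball, weighted by the density, is bounded uniformly on bounded
time intervals. -/
theorem exists_rate_bound (hS : ∀ l, IsHyperplaneOfCodimGETwo (S l)) {s : Fin m → Space d}
    (hj : IsCurrent (configSpace S) j)
    (hJ : BoundedOnBoundedSets (configSpace S) fun p => (j p).2)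
    (hj0 : BoundedOnBoundedSets (configSpace S) fun p => fderiv ℝ (fun x => (j x).1) p)
    (T R : ℝ) : ∃ B : ℝ≥0∞, B < ⊤ ∧ ∀ t ∈ Icc 0 T,
      ∫⁻ y in configSpace S, ENNReal.ofReal (j (t, y)).1 *
        (closedBall 0 R).indicator (fun y => ENNReal.ofReal (logRate S s j c (t, y))) y ≤ B := by
  set A : Set (SpaceTime d) := {p | p ∈ domain (configSpace S) ∧ p ∈ Icc 0 T ×ˢ closedBall 0 R}
  have hAb : Bornology.IsBounded A :=
    ((isBounded_Icc 0 T).prod isBounded_closedBall).subset fun p hp => hp.2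
  obtain ⟨C₁, hC₁⟩ := hj0 A (fun p hp => hp.1) hAb
  obtain ⟨C₂, hC₂⟩ := hJ A (fun p hp => hp.1) hAb
  have hfin : ∀ l, 2 ≤ Module.finrank ℝ (S l).directionᗮ := fun l => by
    have h1 := Submodule.finrank_add_finrank_orthogonal (S l).direction
    have h2 := (hS l).2
    rw [finrank_euclideanSpace_fin] at h1
    omega
  refine ⟨∫⁻ y in closedBall 0 R, (ENNReal.ofReal (|C₁| * (1 + |c|)) +
        ∑ l, ENNReal.ofReal (2 * |C₂|) * ENNReal.ofReal ‖normalPart (S l) (s l) y‖⁻¹), ?_, ?_⟩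
  · have hmeas : ∀ l, Measurable fun y => ENNReal.ofReal ‖normalPart (S l) (s l) y‖⁻¹ := fun l =>
      ((continuous_normalPart (S l) (s l)).norm.measurable.inv).ennreal_ofReal
    rw [lintegral_add_left measurable_const, lintegral_finsetSum _ fun l _ =>
      (hmeas l).const_mul _]
    refine ENNReal.add_lt_top.2 ⟨?_, ENNReal.sum_lt_top.2 fun l _ => ?_⟩
    · rw [setLIntegral_const]
      exact ENNReal.mul_lt_top ENNReal.ofReal_lt_top measure_closedBall_lt_top
    · rw [lintegral_const_mul _ (hmeas l)]
      exact ENNReal.mul_lt_top ENNReal.ofReal_lt_top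
        (lintegral_inv_norm_starProjection_sub_lt_top _ (hfin l) R (s l))
  · intro t ht
    rw [← lintegral_indicator (isOpen_configSpace S).measurableSet,
      ← lintegral_indicator measurableSet_closedBall]
    refine lintegral_mono fun y => ?_
    by_cases hy : y ∈ configSpace S
    · by_cases hyR : y ∈ closedBall 0 R
      · rw [indicator_of_mem hy, indicator_of_mem hyR, indicator_of_mem hyR]
        have hpA : ((t, y) : SpaceTime d) ∈ A := ⟨hy, ht, hyR⟩
        exact density_mul_logRate_le hj (p := (t, y)) hy (abs_nonneg _) (abs_nonneg _)
          ((hC₁ _ hpA).trans (le_abs_self _)) ((hC₂ _ hpA).trans (le_abs_self _))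
      · rw [indicator_of_mem hy, indicator_of_notMem hyR, mul_zero]
        exact zero_le
    · rw [indicator_of_notMem hy]
      exact zero_le

/-- Speed at most `|c|` confines the trajectories to a ball, where the weighted rate is integrable.
-/
theorem norm_maxSol_le (hj : IsCurrent (configSpace S) j)
    (hc : ∀ p ∈ domain (configSpace S), ‖(j p).2‖ ≤ c * (j p).1) {q : Space d} {t : ℝ}
    (ht : 0 ≤ t) (hq : q ∈ survivalSet (region (configSpace S) j) (velocity j) t) :
    ‖maxSol (region (configSpace S) j) (velocity j) q t‖ ≤ ‖q‖ + |c| * t := by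
  have hL := isLocLipField_velocity (isOpen_configSpace S) hj
  have hsol := hL.isODESolution_maxSol hq.1
  have hsub := hL.Icc_subset_maxDom hq
  have h := (convex_Icc 0 t).norm_image_sub_le_of_norm_hasDerivWithin_le
    (fun s hs => (hsol.hasDerivAt s (hsub hs)).hasDerivWithinAt)
    (fun s hs => norm_velocity_le hj hc (hsol.mem s (hsub hs))) ⟨le_rfl, ht⟩ ⟨ht, le_rfl⟩
  rw [hsol.initial, sub_zero, Real.norm_of_nonneg ht] at h
  linarith [norm_le_norm_sub_add (maxSol (region (configSpace S) j) (velocity j) q t) q]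

/-- Almost every trajectory starting in a ball exists on `[0, T]`. -/
theorem ae_Icc_subset_maxDom (hS : ∀ l, IsHyperplaneOfCodimGETwo (S l))
    (hj : IsCurrent (configSpace S) j)
    (hc : ∀ p ∈ domain (configSpace S), ‖(j p).2‖ ≤ c * (j p).1)
    (hJ : BoundedOnBoundedSets (configSpace S) fun p => (j p).2)
    (hj0 : BoundedOnBoundedSets (configSpace S) fun p => fderiv ℝ (fun x => (j x).1) p)
    (T R : ℝ) : ∀ᵐ q : Space d, q ∈ closedBall 0 R → (0, q) ∈ region (configSpace S) j →
      Icc 0 T ⊆ maxDom (region (configSpace S) j) (velocity j) q := by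
  choose s hs using fun l => (hS l).1
  have hconf := isOpen_configSpace S
  have hL := isLocLipField_velocity hconf hj
  set G := region (configSpace S) j with hG
  set V := velocity j with hV
  set F := forwardDomain G V with hF
  have hFm : MeasurableSet F := hL.isOpen_forwardDomain.measurableSet
  obtain ⟨B, hB, hBbound⟩ := exists_rate_bound (c := c) (s := s) hS hj hJ hj0 T (R + |c| * T)
  set g : Space d × ℝ → ℝ := fun z => (j (0, z.1)).1 * logRate S s j c (z.2, maxSol G V z.1 z.2)
    with hg
  classical
  -- The weighted rate along the trajectory, set to 0 once the trajectory has ended; it is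
  -- measurable because `g` is continuous on the open set `F`.
  set K : Space d × ℝ → ℝ≥0∞ := fun z => ENNReal.ofReal (F.piecewise g 0 z) with hK
  have hgc : ContinuousOn g F := by
    refine ContinuousOn.mul ?_ ?_
    · have h1 : ContinuousOn (fun p => (j p).1) (domain (configSpace S)) :=
        hj.contDiffOn.continuousOn.fst
      exact h1.comp (f := fun z : Space d × ℝ => ((0 : ℝ), z.1)) (by fun_prop)
        fun z hz => hz.2.1.1
    · refine (continuousOn_logRate hs hj).comp
        (continuousOn_snd.prodMk hL.continuousOn_forwardDomain) fun z hz => ?_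
      exact (hL.isODESolution_maxSol hz.2.1).mem _ hz.2.2
  have hKm : Measurable K :=
    (ContinuousOn.measurable_piecewise hgc continuousOn_const hFm).ennreal_ofReal
  have hKin : ∀ z ∈ F, K z = ENNReal.ofReal (j (0, z.1)).1 *
      ENNReal.ofReal (logRate S s j c (z.2, maxSol G V z.1 z.2)) := fun z hz => by
    simp only [hK]
    rw [piecewise_eq_of_mem _ _ _ hz, hg,
      ENNReal.ofReal_mul (hj.pos hz.2.1).le]
  have hKout : ∀ z ∉ F, K z = 0 := fun z hz => by
    simp only [hK]
    rw [piecewise_eq_of_notMem _ _ _ hz]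
    simp
  have hbound : ∫⁻ q in closedBall (0 : Space d) R, ∫⁻ t in Ioc 0 T, K (q, t) < ⊤ := by
    rw [lintegral_lintegral_swap (f := fun q t => K (q, t)) hKm.aemeasurable]
    -- At fixed `t`, transport replaces the weight `j⁰(0, q)` by `j⁰(t, y)` at `y = Q_q(t)`, so the
    -- slice is bounded by `B` uniformly in `t`.
    have hslice : ∀ t ∈ Ioc 0 T, ∫⁻ q in closedBall (0 : Space d) R, K (q, t) ≤ B := by
      intro t ht
      refine le_trans ?_ (hBbound t ⟨ht.1.le, ht.2⟩)
      refine le_trans ?_ (lintegral_flow_le hconf hj ht.1.le _)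
      rw [← lintegral_indicator measurableSet_closedBall,
        ← lintegral_indicator (hL.isOpen_survivalSet ht.1.le).measurableSet]
      refine lintegral_mono fun q => ?_
      by_cases hq : q ∈ survivalSet G V t
      · by_cases hqR : q ∈ closedBall (0 : Space d) R
        · have hmem : maxSol G V q t ∈ closedBall (0 : Space d) (R + |c| * T) := by
            rw [mem_closedBall_zero_iff] at hqR ⊢
            refine (norm_maxSol_le hj hc ht.1.le hq).trans ?_
            gcongr
            exact ht.2
          rw [indicator_of_mem hq, indicator_of_mem hqR, indicator_of_mem hmem,
            hKin (q, t) ⟨ht.1, hq⟩]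
        · rw [indicator_of_notMem hqR]
          exact zero_le
      · refine (indicator_le_self _ _ q).trans ?_
        rw [hKout (q, t) fun h => hq h.2]
        exact zero_le
    calc _ ≤ ∫⁻ _ in Ioc 0 T, B := setLIntegral_mono measurable_const hslice
      _ < ⊤ := by
        rw [setLIntegral_const]
        exact ENNReal.mul_lt_top hB (by simp)
  have hae := ae_lt_top (μ := volume.restrict (closedBall (0 : Space d) R))
    (hKm.lintegral_prod_right' (ν := volume.restrict (Ioc 0 T))) hbound.ne
  rw [ae_restrict_iff' measurableSet_closedBall] at hae
  filter_upwards [hae] with q hq hqR hqG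
  by_contra hcon
  have hsol := hL.isODESolution_maxSol hqG
  obtain ⟨b, hb, hbT, hbI, hsub⟩ := exists_first_exit hsol.isOpen hsol.zero_mem hcon
  have hIoo : Ioo 0 b ⊆ Ioc 0 T := fun t ht => ⟨ht.1, ht.2.le.trans hbT⟩
  -- Up to the exit time `b` the function `K (q, ·)` is the true rate times the positive constant
  -- `j⁰(0, q)`, so finiteness passes to the rate.
  have h1 : ∫⁻ t in Ioo 0 b, K (q, t) < ⊤ := lt_of_le_of_lt (lintegral_mono_set hIoo) (hq hqR)
  have h2 : ∫⁻ t in Ioo 0 b, K (q, t) = ∫⁻ t in Ioo 0 b, ENNReal.ofReal (j (0, q)).1 *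
      ENNReal.ofReal (logRate S s j c (t, maxSol G V q t)) :=
    setLIntegral_congr_fun measurableSet_Ioo fun t ht => by
      have hmem : (q, t) ∈ F := ⟨ht.1, hqG, hsub (Ioo_subset_Ico_self ht)⟩
      exact hKin (q, t) hmem
  rw [h2, lintegral_const_mul' _ _ ENNReal.ofReal_ne_top] at h1
  have h3 : ENNReal.ofReal (j (0, q)).1 ≠ 0 := (ENNReal.ofReal_pos.2 (hj.pos hqG)).ne'
  exact not_exit hs hj hc hqG hb hbI hsub (ENNReal.lt_top_of_mul_ne_top_right h1.ne h3).ne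

/-- A countable intersection, with one `n` serving as both radius and time. -/
theorem ae_Ici_subset_maxDom (hS : ∀ l, IsHyperplaneOfCodimGETwo (S l))
    (hj : IsCurrent (configSpace S) j)
    (hc : ∀ p ∈ domain (configSpace S), ‖(j p).2‖ ≤ c * (j p).1)
    (hJ : BoundedOnBoundedSets (configSpace S) fun p => (j p).2)
    (hj0 : BoundedOnBoundedSets (configSpace S) fun p => fderiv ℝ (fun x => (j x).1) p) :
    ∀ᵐ q : Space d, (0, q) ∈ region (configSpace S) j →
      Ici 0 ⊆ maxDom (region (configSpace S) j) (velocity j) q := by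
  have h : ∀ᵐ q : Space d, ∀ n : ℕ, q ∈ closedBall 0 (n : ℝ) →
      (0, q) ∈ region (configSpace S) j →
      Icc 0 (n : ℝ) ⊆ maxDom (region (configSpace S) j) (velocity j) q :=
    ae_all_iff.2 fun n => ae_Icc_subset_maxDom hS hj hc hJ hj0 n n
  filter_upwards [h] with q hq hqG t ht
  obtain ⟨n, hn⟩ := exists_nat_ge (max ‖q‖ t)
  exact hq n (by simpa using (le_max_left _ _).trans hn) hqG ⟨ht, (le_max_right _ _).trans hn⟩

end

/-! ### The flow map and equivariance at nonnegative times. -/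

section

variable {d : ℕ} {conf : Set (Space d)} {j : SpaceTime d → SpaceTime d} {q : Space d} {t : ℝ}

theorem isMaximalSolution_maxSol (hconf : IsOpen conf) (hj : IsCurrent conf j)
    (hq : (0, q) ∈ region conf j) :
    IsMaximalSolution conf j q (maxDom (region conf j) (velocity j) q)
      (maxSol (region conf j) (velocity j) q) := by
  have hL := isLocLipField_velocity hconf hj
  refine ⟨isODESolution_iff.1 (hL.isODESolution_maxSol hq), fun I' Q' h => ?_⟩
  have h' := isODESolution_iff.2 h
  exact ⟨h'.subset_maxDom, hL.maxSol_eqOn h'⟩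

/-- The value chosen in `flow` comes from some maximal solution, which agrees with `maxSol` by
uniqueness. -/
theorem flow_eq_some (hconf : IsOpen conf) (hj : IsCurrent conf j)
    (hq : (0, q) ∈ region conf j) (ht : t ∈ maxDom (region conf j) (velocity j) q) :
    flow conf j t q = some (maxSol (region conf j) (velocity j) q t) := by
  have hex : ∃ x : Space d, ∃ (I : Set ℝ) (Q : ℝ → Space d),
      IsMaximalSolution conf j q I Q ∧ t ∈ I ∧ x = Q t :=
    ⟨_, _, _, isMaximalSolution_maxSol hconf hj hq, ht, rfl⟩
  rw [flow, dif_pos hex]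
  obtain ⟨I, Q, hIQ, htI, hx⟩ := hex.choose_spec
  rw [hx, (isLocLipField_velocity hconf hj).maxSol_eqOn (isODESolution_iff.2 hIQ.1) htI]

theorem measurable_some : Measurable (some : Space d → Option (Space d)) := fun _ hs => hs

theorem continuousOn_density (hj : IsCurrent conf j) (t : ℝ) :
    ContinuousOn (fun q => (j (t, q)).1) conf :=
  (hj.contDiffOn.continuousOn.fst).comp (f := fun q : Space d => (t, q)) (by fun_prop)
    fun _ hq => hq

theorem aemeasurable_density (hconf : IsOpen conf) (hj : IsCurrent conf j) (t : ℝ) :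
    AEMeasurable (fun q => ENNReal.ofReal (j (t, q)).1) (volume.restrict conf) :=
  ((continuousOn_density hj t).aemeasurable hconf.measurableSet).ennreal_ofReal

theorem densityMeasure_univ (hconf : IsOpen conf) (hj : IsCurrent conf j) (t : ℝ) :
    densityMeasure conf j t univ = 1 := by
  -- Total integral 1 forces integrability, since the integral of a non-integrable function is 0 by
  -- convention.
  have hint : IntegrableOn (fun q => (j (t, q)).1) conf := by
    by_contra hcon
    have h1 := hj.integral_eq_one t
    rw [integral_undef hcon] at h1
    exact zero_ne_one h1
  rw [densityMeasure, withDensity_apply _ MeasurableSet.univ, Measure.restrict_univ,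
    ← ofReal_integral_eq_lintegral_ofReal hint, hj.integral_eq_one t, ENNReal.ofReal_one]
  filter_upwards [ae_restrict_mem hconf.measurableSet] with q hq
  exact hj.nonneg (p := (t, q)) hq

/-- Nodes at time 0 carry no mass because the density vanishes there. -/
theorem ae_densityMeasure (hconf : IsOpen conf) (hj : IsCurrent conf j) {P : Space d → Prop}
    (h : ∀ᵐ q : Space d, (0, q) ∈ region conf j → P q) :
    ∀ᵐ q ∂(densityMeasure conf j 0), P q := by
  rw [densityMeasure, ae_withDensity_iff' (aemeasurable_density hconf hj 0)]
  filter_upwards [ae_restrict_of_ae h, ae_restrict_mem hconf.measurableSet] with q hq hqc hne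
  refine hq ⟨hqc, fun h0 => hne ?_⟩
  simp [h0]

/-- Equivariance at time `t ≥ 0` when almost all trajectories survive until `t`. -/
theorem equivariant_of_ae_survival (hconf : IsOpen conf) (hj : IsCurrent conf j) (ht : 0 ≤ t)
    (hsurv : ∀ᵐ q ∂(densityMeasure conf j 0), q ∈ survivalSet (region conf j) (velocity j) t) :
    AEMeasurable (flow conf j t) (densityMeasure conf j 0) ∧
      flowDistribution conf j t = (densityMeasure conf j t).map some := by
  classical
  have hL := isLocLipField_velocity hconf hj
  set D := survivalSet (region conf j) (velocity j) t with hD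
  set Φ : Space d → Space d := fun q => maxSol (region conf j) (velocity j) q t with hΦ
  have hDm : MeasurableSet D := (hL.isOpen_survivalSet ht).measurableSet
  have hΦc : ContinuousOn Φ D := fun q hq => by
    obtain ⟨Y, hY, -⟩ := exists_fderiv_flow hconf hj ht hq
    exact hY.continuousAt.continuousWithinAt
  -- The value 0 off `D` is arbitrary: the complement of `D` is `μ_0`-null.
  have hm : Measurable (D.piecewise Φ 0) :=
    ContinuousOn.measurable_piecewise hΦc continuousOn_const hDm
  have heq : flow conf j t =ᵐ[densityMeasure conf j 0] some ∘ D.piecewise Φ 0 := by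
    filter_upwards [hsurv] with q hq
    rw [Function.comp_apply, piecewise_eq_of_mem _ _ _ hq, flow_eq_some hconf hj hq.1 hq.2]
  refine ⟨⟨_, measurable_some.comp hm, heq⟩, ?_⟩
  rw [flowDistribution, Measure.map_congr heq, ← Measure.map_map measurable_some hm]
  congr 1
  have hfin : IsFiniteMeasure (densityMeasure conf j 0) :=
    ⟨by rw [densityMeasure_univ hconf hj]; exact ENNReal.one_lt_top⟩
  -- One inequality and equal finite total mass give equality; no lower bound on the image measure
  -- is needed.
  refine Measure.eq_of_le_of_measure_univ_eq ?_ ?_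
  · refine Measure.le_iff.2 fun A hA => ?_
    have hAm : MeasurableSet (D.piecewise Φ 0 ⁻¹' A ∩ D) := (hm hA).inter hDm
    rw [Measure.map_apply hm hA]
    have h1 : densityMeasure conf j 0 (D.piecewise Φ 0 ⁻¹' A) =
        densityMeasure conf j 0 (D.piecewise Φ 0 ⁻¹' A ∩ D) := by
      refine measure_congr ?_
      filter_upwards [hsurv] with q hq
      exact propext ⟨fun h => ⟨h, hq⟩, fun h => h.1⟩
    rw [h1, densityMeasure, withDensity_apply _ hAm, Measure.restrict_restrict hAm,
      inter_eq_self_of_subset_left (inter_subset_right.trans (survivalSet_subset t)),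
      densityMeasure, withDensity_apply _ hA]
    have h2 := lintegral_flow_le hconf hj ht (A.indicator 1)
    calc _ = ∫⁻ q in D, ENNReal.ofReal (j (0, q)).1 * A.indicator 1 (Φ q) := by
          rw [← lintegral_indicator hAm, ← lintegral_indicator hDm]
          refine lintegral_congr fun q => ?_
          by_cases hq : q ∈ D
          · by_cases hqA : Φ q ∈ A <;> simp [indicator, hq, hqA]
          · simp [indicator, hq]
      _ ≤ _ := h2
      _ = _ := by
          rw [← lintegral_indicator hA]
          refine lintegral_congr fun q => ?_
          by_cases hq : q ∈ A <;> simp [hq]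
  · rw [Measure.map_apply hm MeasurableSet.univ, preimage_univ, densityMeasure_univ hconf hj,
      densityMeasure_univ hconf hj]

end

/-! ### Time reversal. -/

section Reversal

variable {d : ℕ} {conf : Set (Space d)} {j : SpaceTime d → SpaceTime d} {q : Space d} {t : ℝ}

/-- Time reflection of space-time. -/
def timeReflection (d : ℕ) : SpaceTime d ≃L[ℝ] SpaceTime d :=
  (ContinuousLinearEquiv.neg ℝ).prodCongr (ContinuousLinearEquiv.refl ℝ (Space d))

@[simp]
theorem timeReflection_apply (p : SpaceTime d) : timeReflection d p = (-p.1, p.2) := rfl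

/-- The time-reversed current. -/
def reversed (j : SpaceTime d → SpaceTime d) (p : SpaceTime d) : SpaceTime d :=
  ((j (timeReflection d p)).1, -(j (timeReflection d p)).2)

theorem fderiv_reversed_fst (p : SpaceTime d) :
    fderiv ℝ (fun x => (reversed j x).1) p =
      (fderiv ℝ (fun x => (j x).1) (timeReflection d p)).comp
        (timeReflection d : SpaceTime d →L[ℝ] SpaceTime d) :=
  (timeReflection d).comp_right_fderiv (f := fun x => (j x).1)

theorem fderiv_reversed_snd (p : SpaceTime d) (i : Fin d) :
    fderiv ℝ (fun x => (reversed j x).2 i) p =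
      -(fderiv ℝ (fun x => (j x).2 i) (timeReflection d p)).comp
        (timeReflection d : SpaceTime d →L[ℝ] SpaceTime d) := by
  rw [← (timeReflection d).comp_right_fderiv (f := fun x => (j x).2 i), ← fderiv_neg]
  rfl

/-- Reflection changes the sign of the time derivative of `j⁰`, and the minus sign on `J` that of
the spatial divergence. -/
theorem divergence_reversed (p : SpaceTime d) :
    divergence (reversed j) p = -divergence j (timeReflection d p) := by
  have h1 : timeReflection d (1, 0) = -(1, 0) := by simp
  have h2 : ∀ v : Space d, timeReflection d (0, v) = (0, v) := fun v => by simp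
  simp only [divergence, fderiv_reversed_fst, fderiv_reversed_snd, neg_apply,
    ContinuousLinearMap.comp_apply, ContinuousLinearEquiv.coe_coe, h1, h2, map_neg,
    Finset.sum_neg_distrib, neg_add]

theorem reversed_eq_zero_iff (p : SpaceTime d) :
    reversed j p = 0 ↔ j (timeReflection d p) = 0 := by
  simp [reversed, Prod.ext_iff]

theorem isCurrent_reversed (hj : IsCurrent conf j) : IsCurrent conf (reversed j) := by
  have hmaps : MapsTo (timeReflection d) (domain conf) (domain conf) := fun p hp => hp
  refine ⟨?_, fun p hp => ?_, fun p hp hne => ?_, fun t => ?_⟩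
  · have h1 := hj.contDiffOn.comp (timeReflection d).contDiff.contDiffOn hmaps
    exact h1.fst.prodMk h1.snd.neg
  · rw [divergence_reversed, hj.divergence_eq_zero _ (hmaps hp), neg_zero]
  · exact hj.pos_of_ne_zero _ (hmaps hp) fun h => hne ((reversed_eq_zero_iff p).2 h)
  · exact hj.integral_eq_one (-t)

theorem BoundedOnBoundedSets.comp_timeReflection {F : Type*} [SeminormedAddCommGroup F]
    {f : SpaceTime d → F} (h : BoundedOnBoundedSets conf f) :
    BoundedOnBoundedSets conf fun p => f (timeReflection d p) := by
  intro B hB hBb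
  obtain ⟨C, hC⟩ := h (timeReflection d '' B) (by
    rintro _ ⟨p, hp, rfl⟩
    have hpd := hB hp
    exact hpd) (hBb.image (timeReflection d : SpaceTime d →L[ℝ] SpaceTime d))
  exact ⟨C, fun p hp => hC _ (mem_image_of_mem _ hp)⟩

/-- Reflecting a trajectory of the reversed current gives a trajectory of the current. -/
theorem IsSolution.of_reversed {I : Set ℝ} {Q : ℝ → Space d}
    (h : IsSolution conf (reversed j) q I Q) :
    IsSolution conf j q (Neg.neg ⁻¹' I) (fun t => Q (-t)) := by
  refine ⟨h.isOpen.preimage continuous_neg, ⟨fun s hs u hu r hr => ?_⟩, ?_, ?_,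
    fun t ht => h.mem_conf _ ht, fun t ht => ?_, fun t ht => ?_⟩
  · exact h.ordConnected.out hu hs ⟨neg_le_neg hr.2, neg_le_neg hr.1⟩
  · simpa using h.zero_mem
  · simpa using h.initial
  · have h1 := h.not_node _ ht
    rw [ne_eq, reversed_eq_zero_iff] at h1
    simpa using h1
  · have h1 := (h.hasDerivAt _ ht).scomp t (hasDerivAt_neg t)
    refine h1.congr_deriv ?_
    simp [reversed]

/-- The reflected maximal trajectory of the reversed current solves the original equation, hence is
part of its maximal solution. -/
theorem flow_neg_eq_some (hconf : IsOpen conf) (hj : IsCurrent conf j)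
    (hq : (0, q) ∈ region conf (reversed j))
    (ht : t ∈ maxDom (region conf (reversed j)) (velocity (reversed j)) q) :
    -t ∈ maxDom (region conf j) (velocity j) q ∧
      flow conf j (-t) q = flow conf (reversed j) t q := by
  have hj' := isCurrent_reversed hj
  have hsol := isODESolution_iff.2 (IsSolution.of_reversed (isODESolution_iff.1
    ((isLocLipField_velocity hconf hj').isODESolution_maxSol hq)))
  have hmem : -t ∈ Neg.neg ⁻¹' maxDom (region conf (reversed j)) (velocity (reversed j)) q := by
    simpa using ht
  have hq' : (0, q) ∈ region conf j := by
    have := hsol.mem 0 hsol.zero_mem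
    rwa [hsol.initial] at this
  refine ⟨hsol.subset_maxDom hmem, ?_⟩
  rw [flow_eq_some hconf hj hq' (hsol.subset_maxDom hmem), flow_eq_some hconf hj' hq ht,
    ← (isLocLipField_velocity hconf hj).maxSol_eqOn hsol hmem]
  simp only [neg_neg]

theorem region_reversed_zero (h : (0, q) ∈ region conf j) : (0, q) ∈ region conf (reversed j) := by
  refine ⟨h.1, fun h0 => h.2 ?_⟩
  rw [reversed_eq_zero_iff] at h0
  simpa using h0

theorem densityMeasure_reversed (t : ℝ) :
    densityMeasure conf (reversed j) t = densityMeasure conf j (-t) := rfl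

end Reversal

end CurrentFlow

end

/-! ### Combination of both time directions. -/

theorem mainTheorem5 (d m : ℕ) (S : Fin m → AffineSubspace ℝ (CurrentFlow.Space d))
    (hS : ∀ l, CurrentFlow.IsHyperplaneOfCodimGETwo (S l))
    (j : CurrentFlow.SpaceTime d → CurrentFlow.SpaceTime d)
    (hj : CurrentFlow.IsCurrent (CurrentFlow.configSpace S) j)
    (c : ℝ)
    (hc : ∀ p ∈ CurrentFlow.domain (CurrentFlow.configSpace S), ‖(j p).2‖ ≤ c * (j p).1)
    (hJ : CurrentFlow.BoundedOnBoundedSets (CurrentFlow.configSpace S) fun p => (j p).2)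
    (hj0 : CurrentFlow.BoundedOnBoundedSets (CurrentFlow.configSpace S)
      fun p => fderiv ℝ (fun x => (j x).1) p) :
    (∀ᵐ q ∂(CurrentFlow.densityMeasure (CurrentFlow.configSpace S) j 0),
      ∃ Q : ℝ → CurrentFlow.Space d,
        CurrentFlow.IsMaximalSolution (CurrentFlow.configSpace S) j q Set.univ Q) ∧
    CurrentFlow.IsEquivariant (CurrentFlow.configSpace S) j := by
  open CurrentFlow in
  have hconf := isOpen_configSpace S
  have hr := isCurrent_reversed hj
  have hJr : BoundedOnBoundedSets (configSpace S) fun p => (reversed j p).2 := fun B hB hBb => by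
    obtain ⟨C, hC⟩ := hJ.comp_timeReflection B hB hBb
    exact ⟨C, fun p hp => by simpa [reversed] using hC p hp⟩
  have hj0r : BoundedOnBoundedSets (configSpace S)
      fun p => fderiv ℝ (fun x => (reversed j x).1) p := fun B hB hBb => by
    obtain ⟨C, hC⟩ := hj0.comp_timeReflection B hB hBb
    refine ⟨C * ‖(timeReflection d : SpaceTime d →L[ℝ] SpaceTime d)‖, fun p hp => ?_⟩
    change ‖fderiv ℝ (fun x => (reversed j x).1) p‖ ≤ _
    rw [fderiv_reversed_fst]
    exact (ContinuousLinearMap.opNorm_comp_le _ _).trans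
      (mul_le_mul_of_nonneg_right (hC p hp) (norm_nonneg _))
  have hcr : ∀ p ∈ domain (configSpace S), ‖(reversed j p).2‖ ≤ c * (reversed j p).1 :=
    fun p hp => by simpa [reversed] using hc (timeReflection d p) hp
  have hfwd := ae_Ici_subset_maxDom hS hj hc hJ hj0
  have hbwd := ae_Ici_subset_maxDom hS hr hcr hJr hj0r
  refine ⟨ae_densityMeasure hconf hj ?_, fun t => ?_⟩
  · filter_upwards [hfwd, hbwd] with q hq hq' hqG
    have huniv : maxDom (region (configSpace S) j) (velocity j) q = Set.univ := by
      refine Set.eq_univ_of_forall fun t => ?_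
      rcases le_total 0 t with ht | ht
      · exact hq hqG ht
      · have hqr := region_reversed_zero hqG
        have := (flow_neg_eq_some hconf hj hqr
          (hq' hqr (Set.mem_Ici.2 (neg_nonneg.2 ht)))).1
        rwa [neg_neg] at this
    exact ⟨_, huniv ▸ isMaximalSolution_maxSol hconf hj hqG⟩
  · rcases le_total 0 t with ht | ht
    · refine equivariant_of_ae_survival hconf hj ht (ae_densityMeasure hconf hj ?_)
      filter_upwards [hfwd] with q hq hqG
      exact ⟨hqG, hq hqG ht⟩
    · have ht' : 0 ≤ -t := neg_nonneg.2 ht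
      -- The reversed current has the same measure at time 0, and its measure at time `-t` is `μ_t`.
      have h := equivariant_of_ae_survival hconf hr ht' (ae_densityMeasure hconf hr (by
        filter_upwards [hbwd] with q hq hqG
        exact ⟨hqG, hq hqG ht'⟩))
      rw [flowDistribution, densityMeasure_reversed, densityMeasure_reversed, neg_zero,
        neg_neg] at h
      have heq : flow (configSpace S) (reversed j) (-t) =ᵐ[densityMeasure (configSpace S) j 0]
          flow (configSpace S) j t := by
        refine ae_densityMeasure hconf hj ?_
        filter_upwards [hbwd] with q hq hqG
        have hqr := region_reversed_zero hqG
        have := (flow_neg_eq_some hconf hj hqr (hq hqr ht')).2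
        rw [neg_neg] at this
        exact this.symm
      refine ⟨h.1.congr heq, ?_⟩
      rw [flowDistribution, ← h.2, Measure.map_congr heq]
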